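/- **Setting.** Let $n\ge 0$, let $A,A_n,A_d\in\mathbb R^{n\times n}$ and let $1\le d_m\le d_n\le d_M$ be integers. For a delay signal $d:\mathbb N\to\{d_m,\dots,d_M\}$ consider $$x(k+1)=A\,x(k)+A_n\,x(k-d_n)+A_d\,x(k-d(k)),\qquad k\ge 0,\tag{1}$$ with arbitrary initial values $x(k)$, $-d_M\le k\le 0$. Put $$A_{m_1}=0,\ A_{M_1}=A_n,\ d_{m_1}=d_m,\ d_{M_1}=d_n;\qquad A_{m_2}=A_n,\ A_{M_2}=0,\ d_{m_2}=d_n,\ d_{M_2}=d_M,$$ and $\sigma(k)=1$ if $d(k)\le d_n$, $\sigma(k)=2$ if $d(k)>d_n$. Then (1) is the two-mode switched delay system $$x(k+1)=A\,x(k)+A_{m_{\sigma(k)}}x(k-d_{m_{\sigma(k)}})+A_{M_{\sigma(k)}}x(k-d_{M_{\sigma(k)}})+A_d\,x(k-d(k)),\qquad k\ge0.\tag{2}$$ **Notation.** For $j\in\{1,2\}$ let $d_{\Delta_j}=d_{M_j}-d_{m_j}$ and $d_{\Delta_M}=d_M-d_{M_j}$ (in mode $j$); $\gamma(1)=1$ and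 $\gamma(d)=\frac{d+1}{d-1}$ for $d>1$; $\mathrm{He}\{Y\}=Y+Y^\top$; $\mathbb S_m^+$ is the set of symmetric positive definite $m\times m$ matrices; $\prec0$, $\succ 0$ mean negative, positive definite. All matrices below consist of $n\times n$ blocks; a number $t$ standing for a block means $tI_n$. *Block rows with 8 blocks (mode 2) or 10 blocks (mode 1).* Let $e_1,e_2,\dots$ be the block rows having the block $I_n$ in the indicated position and zero blocks elsewhere, of length $8+2(2-j)$ in mode $j$. With $a=d_{m_j}$, $b=d_{M_j}$ and rows separated by semicolons, $$W_{\Psi_j}=[\,e_4-e_5;\ e_4+e_5-2e_8;\ e_3-e_4;\ e_3+e_4-2e_7\,],\quad W_{s_j}=[\,e_2-e_3;\ e_2+e_3-2e_6\,],\quad W_{3_j}=e_1-e_2,$$ $$W_{1_j}=[\,e_2;\ -e_2+(a+1)e_6;\ -e_3-e_4+(1-a)e_7+(b+1)e_8\,],$$ $$W_{2_j}=[\,e_1;\ -e_3+(a+1)e_6;\ -e_4-e_5+(1-a)e_7+(b+1)e_8\,],\qquad W_j(d)=[\,0;\ 0;\ d\,e_7-d\,e_8\,],$$ where for $j=1$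 the matrices $W_{1_1},W_{2_1},W_1(d)$ have the additional fourth row $-e_5+(d_{\Delta_M}+1)e_{10}$, $-e_9+(d_{\Delta_M}+1)e_{10}$ and $0$, respectively; and, for $j=1$, $W_z=[\,e_5-e_9;\ e_5+e_9-2e_{10}\,]$ (terms with the factor $2-j$ are absent for $j=2$). *Single-mode matrices.* Given $P_j\in\mathbb S^+_{3n+n(2-j)}$, $Q_{1_j},Q_{2_j},Q_{3_j},Z_{1_j},Z_{2_j},Z_{3_j}\in\mathbb S_n^+$ and $X_j\in\mathbb R^{2n\times2n}$, let $$\mathscr Z_{2_j}=\mathrm{diag}(Z_{2_j},3Z_{2_j}),\quad \Psi_{z_j}=\begin{bmatrix}\mathscr Z_{2_j}&X_j\\X_j^\top&\mathscr Z_{2_j}\end{bmatrix},\quad \mathscr Z_{1_j}=\mathrm{diag}(Z_{1_j},3\gamma(d_{m_j})Z_{1_j}),\quad \mathscr Z_{3_j}=(2-j)\,\mathrm{diag}(Z_{3_j},3Z_{3_j}),$$ $$\mathcal Q_j=\mathrm{diag}\bigl(0,\ Q_{1_j},\ Q_{2_j}-Q_{1_j},\ 0,\ (2-j)Q_{3_j}-Q_{2_j},\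 0,\dots,0\bigr),$$ $$\Phi(d,j)=W_{2_j}^\top P_jW_{2_j}-W_{1_j}^\top P_jW_{1_j}+\mathrm{He}\{W_j(d)^\top P_j(W_{2_j}-W_{1_j})\}+\mathcal Q_j+\Phi_3(j),$$ $$\Phi_3(j)=W_{3_j}^\top\bigl(d_{m_j}^2Z_{1_j}+d_{\Delta_j}^2Z_{2_j}+(2-j)d_{\Delta_M}^2Z_{3_j}\bigr)W_{3_j}-W_{s_j}^\top\mathscr Z_{1_j}W_{s_j}-W_{\Psi_j}^\top\Psi_{z_j}W_{\Psi_j}-W_z^\top\mathscr Z_{3_j}W_z,$$ $$\Gamma_j^\perp=\begin{bmatrix}A\ \ A_{m_j}\ \ A_d\ \ A_{M_j}\ \ 0\ \cdots\ 0\\ I_{7n+2n(2-j)}\end{bmatrix}.$$ *Cross-mode matrices.* Index the $d_M+1$ blocks of the history vector $\bar x=(x(k),x(k-1),\dots,x(k-d_M))$ by $0,\dots,d_M$. Let $W_{5_j}$ be the block matrix mapping $\bar x$ to the vector with blocks $x(k)$, $\sum_{i=1}^{d_{m_j}}x(k-i)$, $\sum_{i=d_{m_j}+1}^{d_{M_j}}x(k-i)$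 and, for $j=1$ only, $\sum_{i=d_{M_1}+1}^{d_M}x(k-i)$. Let $\mathcal H_j$ be the symmetric block-tridiagonal matrix with block indices $0,\dots,d_{M_j}$ whose diagonal blocks are $\mathcal P_0=d_{m_j}^2Z_{1_j}+d_{\Delta_j}^2Z_{2_j}$ at $0$, $\mathcal P_{a_i}=Q_{1_j}+2d_{\Delta_j}^2Z_{2_j}+d_{m_j}(2d_{m_j}-2i+1)Z_{1_j}$ at $i$ for $1\le i\le d_{m_j}$, $\mathcal P_{c_l}=Q_{2_j}+d_{\Delta_j}(2d_{\Delta_j}-2l+1)Z_{2_j}$ at $d_{m_j}+l$ for $1\le l\le d_{\Delta_j}$, and whose off-diagonal blocks are $\mathcal P_{b_i}=-d_{\Delta_j}^2Z_{2_j}-d_{m_j}(d_{m_j}-i+1)Z_{1_j}$ at $(i-1,i)$ for $1\le i\le d_{m_j}$, $\mathcal P_{d_l}=-d_{\Delta_j}(d_{\Delta_j}-l+1)Z_{2_j}$ at $(d_{m_j}+l-1,d_{m_j}+l)$ for $1\le l\le d_{\Delta_j}$. Let $\mathcal H_{a_j}$ be the block-tridiagonal matrix of the same format with block indices $0,\dots,d_M$,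 with $d_{M_j}$ in place of $d_{m_j}$ and $d_{\Delta_M}$ in place of $d_{\Delta_j}$, and with $\mathcal P_0=d_{\Delta_M}^2Z_{3_j}$, $\mathcal P_{a_i}=2d_{\Delta_M}^2Z_{3_j}$, $\mathcal P_{b_i}=-d_{\Delta_M}^2Z_{3_j}$ ($1\le i\le d_{M_j}$), $\mathcal P_{c_l}=d_{\Delta_M}(2d_{\Delta_M}-2l+1)Z_{3_j}$, $\mathcal P_{d_l}=-d_{\Delta_M}(d_{\Delta_M}-l+1)Z_{3_j}$ ($1\le l\le d_{\Delta_M}$). Put $$\mathcal P_j=\mathrm{diag}\bigl(\mathcal H_j,\underbrace{Q_{3_j},\dots,Q_{3_j}}_{d_M-d_{M_j}}\bigr)+(2-j)\mathcal H_{a_j},\qquad S_j=W_{5_j}^\top P_jW_{5_j}+\mathcal P_j .$$ For $1\le l\le d_M$ let $\mathcal L^\perp(l)=\begin{bmatrix}\mathcal L_a^\perp(l)\\ I_{n(d_M+1)}\end{bmatrix}$, where $\mathcal L_a^\perp(l)$ is the block row with $\mathcal L_a^\perp(l)\,\bar x=A\,x(k)+A_n\,x(k-d_n)+A_d\,x(k-l)$.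 **Theorem.** Suppose that for $j\in\{1,2\}$ there are $P_j\in\mathbb S^+_{3n+n(2-j)}$, $Q_{1_j},Q_{2_j},Q_{3_j},Z_{1_j},Z_{2_j},Z_{3_j}\in\mathbb S_n^+$ and $X_j\in\mathbb R^{2n\times2n}$ such that, for $j=1$ and $j=2$, $$\Psi_{z_j}\succ0,\qquad {\Gamma_j^\perp}^\top\Phi(d_{m_j},j)\,\Gamma_j^\perp\prec0,\qquad {\Gamma_j^\perp}^\top\Phi(d_{M_j},j)\,\Gamma_j^\perp\prec0,$$ and such that $$\mathcal L^\perp(l)^\top\bigl[\mathrm{diag}(S_1,0_n)-\mathrm{diag}(0_n,S_2)\bigr]\mathcal L^\perp(l)\prec0\quad\text{for every integer } d_{m_1}\le l\le d_{M_1},$$ $$\mathcal L^\perp(l)^\top\bigl[\mathrm{diag}(S_2,0_n)-\mathrm{diag}(0_n,S_1)\bigr]\mathcal L^\perp(l)\prec0\quad\text{for every integer } d_{m_2}\le l\le d_{M_2}.$$ Then for every time-varying delay $d:\mathbb N\to\{d_m,\dots,d_M\}$ the switched system (2), equivalently system (1), is asymptotically stable: for every $\varepsilon>0$ there is $\delta>0$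 such that every solution with $\|x(k)\|<\delta$ for $-d_M\le k\le0$ satisfies $\|x(k)\|<\varepsilon$ for all $k\ge0$, and every solution satisfies $x(k)\to0$ as $k\to\infty$. -/

import Mathlib

open Matrix Filter Topology

noncomputable section

namespace DelayLMI

/-- Square real blocks of size `n`. -/
abbrev Mat (n : ℕ) := Matrix (Fin n) (Fin n) ℝ

/-- Real matrices made of `a × b` square blocks of size `n`; block indices come first. -/
abbrev BMat (a b n : ℕ) := Matrix (Fin a × Fin n) (Fin b × Fin n) ℝ

/-- Forget the block structure of a matrix of blocks. -/
def flat {a b n : ℕ} (B : Matrix (Fin a) (Fin b) (Mat n)) : BMat a b n :=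
  Matrix.comp (Fin a) (Fin b) (Fin n) (Fin n) ℝ B

/-- The block matrix whose blocks are `w r c • I_n`. -/
def scal (n : ℕ) {a b : ℕ} (w : Matrix (Fin a) (Fin b) ℝ) : BMat a b n :=
  flat (w.map fun t => t • (1 : Mat n))

/-- Block-diagonal matrix. -/
def bdiag {b n : ℕ} (D : Fin b → Mat n) : BMat b b n := flat (Matrix.diagonal D)

/-- `He Y = Y + Yᵀ`. -/
def He {ι : Type*} (Y : Matrix ι ι ℝ) : Matrix ι ι ℝ := Y + Yᵀ

/-- Positive definiteness (symmetry included) of `-Y`. -/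
def NegDef {ι : Type*} (Y : Matrix ι ι ℝ) : Prop := (-Y).PosDef

/-! ### The delay system and its two-mode switched representation -/

/-- The data `A, A_n, A_d, d_m, d_n, d_M` of the delay system. -/
structure DelaySystem (n : ℕ) where
  A : Mat n
  An : Mat n
  Ad : Mat n
  dm : ℕ
  dn : ℕ
  dM : ℕ

/-- The two modes `j = 1` and `j = 2`. -/
inductive Mode where
  | one
  | two

/-- The number `2 - j`. -/
def Mode.e : Mode → ℝ
  | .one => 1
  | .two => 0

/-- The number of blocks of `P_j`, that is `3 + (2 - j)`. -/
abbrev Mode.rows : Mode → ℕ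
  | .one => 4
  | .two => 3

/-- One less than the number of blocks of the extended vector, that is `7 + 2 (2 - j)`. -/
abbrev Mode.cols : Mode → ℕ
  | .one => 9
  | .two => 7

namespace DelaySystem

variable {n : ℕ} (s : DelaySystem n)

/-- Lower delay bound of a mode. -/
def dmj : Mode → ℕ
  | .one => s.dm
  | .two => s.dn

/-- Upper delay bound of a mode. -/
def dMj : Mode → ℕ
  | .one => s.dn
  | .two => s.dM

/-- Matrix multiplying the state delayed by the lower bound. -/
def Amj : Mode → Mat n
  | .one => 0
  | .two => s.An

/-- Matrix multiplying the state delayed by the upper bound. -/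
def AMj : Mode → Mat n
  | .one => s.An
  | .two => 0

/-- `d_{Δ_j} = d_{M_j} - d_{m_j}`. -/
def dDelta (j : Mode) : ℝ := (s.dMj j : ℝ) - (s.dmj j : ℝ)

/-- `d_{Δ_M} = d_M - d_{M_j}`. -/
def dDeltaM (j : Mode) : ℝ := (s.dM : ℝ) - (s.dMj j : ℝ)

/-- The switching rule: mode 1 if the delay is at most `d_n`, mode 2 otherwise. -/
def sigma (delay : ℕ) : Mode := if delay ≤ s.dn then .one else .two

/-- `x` solves the delay system for the delay signal `d`; its restriction to `[-d_M, 0]` is the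
initial condition. -/
def IsSolution (d : ℕ → ℕ) (x : ℤ → Fin n → ℝ) : Prop :=
  ∀ k : ℕ, x (k + 1) = s.A *ᵥ x k + s.An *ᵥ x (k - s.dn) + s.Ad *ᵥ x (k - d k)

/-- The right-hand side `f_j` of the subsystem of mode `j` at time `k`, along `x`. -/
def f (j : Mode) (d : ℕ → ℕ) (x : ℤ → Fin n → ℝ) (k : ℕ) : Fin n → ℝ :=
  s.A *ᵥ x k + s.Amj j *ᵥ x (k - s.dmj j) + s.AMj j *ᵥ x (k - s.dMj j) + s.Ad *ᵥ x (k - d k)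

/-- `x` solves the switched delay system for the delay signal `d`. -/
def IsSwitchedSolution (d : ℕ → ℕ) (x : ℤ → Fin n → ℝ) : Prop :=
  ∀ k : ℕ, x (k + 1) = s.f (s.sigma (d k)) d x k

end DelaySystem

/-- Asymptotic stability of the zero solution of a linear system with memory `[-d_M, 0]`, given
through its set of solutions: Lyapunov stability together with convergence to zero of every
solution. The choice of the norm on `Fin n → ℝ` does not matter. -/
def AsymptoticallyStable {n : ℕ} (dM : ℕ) (sol : (ℤ → Fin n → ℝ) → Prop) : Prop :=
  (∀ ε > 0, ∃ δ > 0, ∀ x, sol x →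
    (∀ i : ℤ, -(dM : ℤ) ≤ i → i ≤ 0 → ‖x i‖ < δ) → ∀ k : ℕ, ‖x k‖ < ε) ∧
  ∀ x, sol x → Tendsto (fun k : ℕ => x k) atTop (𝓝 0)

/-! ### Constant block matrices

The extended vector of mode 2 has the blocks
`x(k+1), x(k), x(k-d_m), x(k-d(k)), x(k-d_M), v₁, v₂, v₃` (with the delay bounds of the mode); in
mode 1 two further blocks `x(k-d_M), v₄` follow. -/

/-- The function `γ`. -/
def gam (d : ℕ) : ℝ := if d = 1 then 1 else ((d : ℝ) + 1) / ((d : ℝ) - 1)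

/-- Upper half of `W_{Ψ_j}`. -/
def wPsiTop : (j : Mode) → Matrix (Fin 2) (Fin (j.cols + 1)) ℝ
  | .one => !![0, 0, 0, 1, -1, 0, 0, 0, 0, 0;
               0, 0, 0, 1, 1, 0, 0, -2, 0, 0]
  | .two => !![0, 0, 0, 1, -1, 0, 0, 0;
               0, 0, 0, 1, 1, 0, 0, -2]

/-- Lower half of `W_{Ψ_j}`. -/
def wPsiBot : (j : Mode) → Matrix (Fin 2) (Fin (j.cols + 1)) ℝ
  | .one => !![0, 0, 1, -1, 0, 0, 0, 0, 0, 0;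
               0, 0, 1, 1, 0, 0, -2, 0, 0, 0]
  | .two => !![0, 0, 1, -1, 0, 0, 0, 0;
               0, 0, 1, 1, 0, 0, -2, 0]

/-- `W_{s_j}`. -/
def wS : (j : Mode) → Matrix (Fin 2) (Fin (j.cols + 1)) ℝ
  | .one => !![0, 1, -1, 0, 0, 0, 0, 0, 0, 0;
               0, 1, 1, 0, 0, -2, 0, 0, 0, 0]
  | .two => !![0, 1, -1, 0, 0, 0, 0, 0;
               0, 1, 1, 0, 0, -2, 0, 0]

/-- `W_z`; in mode 2 it only occurs with the factor `2 - j = 0`. -/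
def wZ : (j : Mode) → Matrix (Fin 2) (Fin (j.cols + 1)) ℝ
  | .one => !![0, 0, 0, 0, 1, 0, 0, 0, -1, 0;
               0, 0, 0, 0, 1, 0, 0, 0, 1, -2]
  | .two => 0

/-- `W_{3_j}`. -/
def w3 : (j : Mode) → Matrix (Fin 1) (Fin (j.cols + 1)) ℝ
  | .one => !![1, -1, 0, 0, 0, 0, 0, 0, 0, 0]
  | .two => !![1, -1, 0, 0, 0, 0, 0, 0]

/-- `W_{1_j}`, with `a = d_{m_j}`, `b = d_{M_j}`, `c = d_{Δ_M}`. -/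
def w1 : (j : Mode) → (a b c : ℝ) → Matrix (Fin j.rows) (Fin (j.cols + 1)) ℝ
  | .one, a, b, c => !![0, 1, 0, 0, 0, 0, 0, 0, 0, 0;
                        0, -1, 0, 0, 0, a + 1, 0, 0, 0, 0;
                        0, 0, -1, -1, 0, 0, 1 - a, b + 1, 0, 0;
                        0, 0, 0, 0, -1, 0, 0, 0, 0, c + 1]
  | .two, a, b, _ => !![0, 1, 0, 0, 0, 0, 0, 0;
                        0, -1, 0, 0, 0, a + 1, 0, 0;
                        0, 0, -1, -1, 0, 0, 1 - a, b + 1]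

/-- `W_{2_j}`, with `a = d_{m_j}`, `b = d_{M_j}`, `c = d_{Δ_M}`. -/
def w2 : (j : Mode) → (a b c : ℝ) → Matrix (Fin j.rows) (Fin (j.cols + 1)) ℝ
  | .one, a, b, c => !![1, 0, 0, 0, 0, 0, 0, 0, 0, 0;
                        0, 0, -1, 0, 0, a + 1, 0, 0, 0, 0;
                        0, 0, 0, -1, -1, 0, 1 - a, b + 1, 0, 0;
                        0, 0, 0, 0, 0, 0, 0, 0, -1, c + 1]
  | .two, a, b, _ => !![1, 0, 0, 0, 0, 0, 0, 0;
                        0, 0, -1, 0, 0, a + 1, 0, 0;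
                        0, 0, 0, -1, -1, 0, 1 - a, b + 1]

/-- `W_j(d)`. -/
def w : (j : Mode) → (d : ℝ) → Matrix (Fin j.rows) (Fin (j.cols + 1)) ℝ
  | .one, d => !![0, 0, 0, 0, 0, 0, 0, 0, 0, 0;
                  0, 0, 0, 0, 0, 0, 0, 0, 0, 0;
                  0, 0, 0, 0, 0, 0, d, -d, 0, 0;
                  0, 0, 0, 0, 0, 0, 0, 0, 0, 0]
  | .two, d => !![0, 0, 0, 0, 0, 0, 0, 0;
                  0, 0, 0, 0, 0, 0, 0, 0;
                  0, 0, 0, 0, 0, 0, d, -d]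

/-! ### Decision variables and the matrix inequalities of a single mode -/

/-- The decision variables of mode `j`. -/
structure Vars (n : ℕ) (j : Mode) where
  P : BMat j.rows j.rows n
  Q₁ : Mat n
  Q₂ : Mat n
  Q₃ : Mat n
  Z₁ : Mat n
  Z₂ : Mat n
  Z₃ : Mat n
  X : BMat 2 2 n

/-- All decision variables except `X` are symmetric positive definite. -/
def Vars.Positive {n : ℕ} {j : Mode} (v : Vars n j) : Prop :=
  v.P.PosDef ∧ v.Q₁.PosDef ∧ v.Q₂.PosDef ∧ v.Q₃.PosDef ∧
    v.Z₁.PosDef ∧ v.Z₂.PosDef ∧ v.Z₃.PosDef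

/-- `Ψ_{z_j}`. -/
def Psi {n : ℕ} {j : Mode} (v : Vars n j) :
    Matrix ((Fin 2 × Fin n) ⊕ (Fin 2 × Fin n)) ((Fin 2 × Fin n) ⊕ (Fin 2 × Fin n)) ℝ :=
  fromBlocks (bdiag ![v.Z₂, (3 : ℝ) • v.Z₂]) v.X v.Xᵀ (bdiag ![v.Z₂, (3 : ℝ) • v.Z₂])

/-- `W_{Ψ_j}`. -/
def WPsi (n : ℕ) (j : Mode) :
    Matrix ((Fin 2 × Fin n) ⊕ (Fin 2 × Fin n)) (Fin (j.cols + 1) × Fin n) ℝ :=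
  fromRows (scal n (wPsiTop j)) (scal n (wPsiBot j))

/-- The block-diagonal matrix `𝒬_j`. -/
def calQ {n : ℕ} : {j : Mode} → Vars n j → BMat (j.cols + 1) (j.cols + 1) n
  | .one, v => bdiag ![0, v.Q₁, v.Q₂ - v.Q₁, 0, v.Q₃ - v.Q₂, 0, 0, 0, 0, 0]
  | .two, v => bdiag ![0, v.Q₁, v.Q₂ - v.Q₁, 0, -v.Q₂, 0, 0, 0]

/-- `Φ₁(d, j)`. -/
def Phi1 {n : ℕ} (s : DelaySystem n) {j : Mode} (v : Vars n j) (d : ℕ) :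
    BMat (j.cols + 1) (j.cols + 1) n :=
  let W₁ := scal n (w1 j (s.dmj j) (s.dMj j) (s.dDeltaM j))
  let W₂ := scal n (w2 j (s.dmj j) (s.dMj j) (s.dDeltaM j))
  W₂ᵀ * v.P * W₂ - W₁ᵀ * v.P * W₁ + He ((scal n (w j d))ᵀ * v.P * (W₂ - W₁))

/-- `Φ₃(j)`. -/
def Phi3 {n : ℕ} (s : DelaySystem n) {j : Mode} (v : Vars n j) :
    BMat (j.cols + 1) (j.cols + 1) n :=
  (scal n (w3 j))ᵀ *
      bdiag ![((s.dmj j : ℝ) ^ 2) • v.Z₁ + (s.dDelta j ^ 2) • v.Z₂ +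
        (j.e * s.dDeltaM j ^ 2) • v.Z₃] *
      scal n (w3 j)
    - (scal n (wS j))ᵀ * bdiag ![v.Z₁, (3 * gam (s.dmj j)) • v.Z₁] * scal n (wS j)
    - (WPsi n j)ᵀ * Psi v * WPsi n j
    - (scal n (wZ j))ᵀ * (j.e • bdiag ![v.Z₃, (3 : ℝ) • v.Z₃]) * scal n (wZ j)

/-- `Φ(d, j)`. -/
def Phi {n : ℕ} (s : DelaySystem n) {j : Mode} (v : Vars n j) (d : ℕ) :
    BMat (j.cols + 1) (j.cols + 1) n :=
  Phi1 s v d + calQ v + Phi3 s v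

/-- First block row of `Γ_j^⊥`. -/
def gammaRow {n : ℕ} (s : DelaySystem n) : (j : Mode) → Fin j.cols → Mat n
  | .one => ![s.A, s.Amj .one, s.Ad, s.AMj .one, 0, 0, 0, 0, 0]
  | .two => ![s.A, s.Amj .two, s.Ad, s.AMj .two, 0, 0, 0]

/-- `Γ_j^⊥`: the row above stacked on an identity matrix. -/
def GammaPerp {n : ℕ} (s : DelaySystem n) (j : Mode) : BMat (j.cols + 1) j.cols n :=
  flat (Matrix.of (vecCons (gammaRow s j) (1 : Matrix (Fin j.cols) (Fin j.cols) (Mat n))))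

/-- The projected matrix `(Γ_j^⊥)ᵀ Φ(d, j) Γ_j^⊥`. -/
def projPhi {n : ℕ} (s : DelaySystem n) {j : Mode} (v : Vars n j) (d : ℕ) :
    BMat j.cols j.cols n :=
  (GammaPerp s j)ᵀ * Phi s v d * GammaPerp s j

/-! ### The functionals as quadratic forms in the whole history, and the cross-mode inequalities

The block `i` of the history vector is `x(k-i)`, `0 ≤ i ≤ d_M`. -/

/-- Symmetric block-tridiagonal matrix: `D i` at `(i, i)` and `O i` at `(i - 1, i)`. -/
def tridiag {n : ℕ} (m : ℕ) (D O : ℕ → Mat n) : BMat m m n :=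
  flat (Matrix.of fun r c =>
    if r = c then D r
    else if (r : ℕ) + 1 = c then O c
    else if (c : ℕ) + 1 = r then (O r)ᵀ
    else 0)

/-- The block-tridiagonal format of `ℋ_j`: block indices `0`, `1, …, p` and `p + 1, …, q`; it is
padded with zeros up to `m` blocks. -/
def chain {n : ℕ} (m p q : ℕ) (P₀ : Mat n) (Pa Pb Pc Pd : ℕ → Mat n) : BMat m m n :=
  tridiag m
    (fun i => if i = 0 then P₀ else if i ≤ p then Pa i else if i ≤ q then Pc (i - p) else 0)
    (fun i => if i ≤ p then Pb i else if i ≤ q then Pd (i - p) else 0)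

/-- `ℋ_j`, padded with zeros to the size of the history vector. -/
def calH {n : ℕ} (s : DelaySystem n) {j : Mode} (v : Vars n j) : BMat (s.dM + 1) (s.dM + 1) n :=
  let a : ℝ := s.dmj j
  let D : ℝ := s.dDelta j
  chain (s.dM + 1) (s.dmj j) (s.dMj j)
    (a ^ 2 • v.Z₁ + D ^ 2 • v.Z₂)
    (fun i => v.Q₁ + (2 * D ^ 2) • v.Z₂ + (a * (2 * a - 2 * i + 1)) • v.Z₁)
    (fun i => -(D ^ 2 • v.Z₂) - (a * (a - i + 1)) • v.Z₁)
    (fun l => v.Q₂ + (D * (2 * D - 2 * l + 1)) • v.Z₂)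
    (fun l => -((D * (D - l + 1)) • v.Z₂))

/-- `ℋ_{a_j}`. -/
def calHa {n : ℕ} (s : DelaySystem n) {j : Mode} (v : Vars n j) : BMat (s.dM + 1) (s.dM + 1) n :=
  let D : ℝ := s.dDeltaM j
  chain (s.dM + 1) (s.dMj j) s.dM
    (D ^ 2 • v.Z₃)
    (fun _ => (2 * D ^ 2) • v.Z₃)
    (fun _ => -(D ^ 2 • v.Z₃))
    (fun l => (D * (2 * D - 2 * l + 1)) • v.Z₃)
    (fun l => -((D * (D - l + 1)) • v.Z₃))

/-- `𝒫_j = diag(ℋ_j, Q₃, …, Q₃) + (2 - j) ℋ_{a_j}`. -/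
def calP {n : ℕ} (s : DelaySystem n) {j : Mode} (v : Vars n j) : BMat (s.dM + 1) (s.dM + 1) n :=
  calH s v + bdiag (fun i : Fin (s.dM + 1) => if s.dMj j < i then v.Q₃ else 0) + j.e • calHa s v

/-- `W_{5_j}`: the linear map from the history vector to the vector whose blocks are `x(k)` and the
sums of `x(k-i)` over `1 ≤ i ≤ d_{m_j}`, over `d_{m_j} < i ≤ d_{M_j}` and, in mode 1 only, over
`d_{M_j} < i ≤ d_M`. -/
def w5 {n : ℕ} (s : DelaySystem n) (j : Mode) : Matrix (Fin j.rows) (Fin (s.dM + 1)) ℝ :=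
  Matrix.of fun r c =>
    if (r : ℕ) = 0 then (if (c : ℕ) = 0 then 1 else 0)
    else if (r : ℕ) = 1 then (if 1 ≤ (c : ℕ) ∧ (c : ℕ) ≤ s.dmj j then 1 else 0)
    else if (r : ℕ) = 2 then (if s.dmj j < c ∧ (c : ℕ) ≤ s.dMj j then 1 else 0)
    else (if s.dMj j < c then 1 else 0)

/-- `S_j = W_{5_j}ᵀ P_j W_{5_j} + 𝒫_j`. -/
def calS {n : ℕ} (s : DelaySystem n) {j : Mode} (v : Vars n j) : BMat (s.dM + 1) (s.dM + 1) n :=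
  (scal n (w5 s j))ᵀ * v.P * scal n (w5 s j) + calP s v

/-- `diag(S, 0_n)`. -/
def padLast {m n : ℕ} (S : BMat m m n) : BMat (m + 1) (m + 1) n :=
  Matrix.of fun p q =>
    Fin.lastCases (motive := fun _ => ℝ) 0
      (fun r => Fin.lastCases (motive := fun _ => ℝ) 0 (fun c => S (r, p.2) (c, q.2)) q.1) p.1

/-- `diag(0_n, S)`. -/
def padFirst {m n : ℕ} (S : BMat m m n) : BMat (m + 1) (m + 1) n :=
  Matrix.of fun p q =>
    Fin.cases (motive := fun _ => ℝ) 0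
      (fun r => Fin.cases (motive := fun _ => ℝ) 0 (fun c => S (r, p.2) (c, q.2)) q.1) p.1

/-- The block row `ℒ_a^⊥(l)`. -/
def lRow {n : ℕ} (s : DelaySystem n) (l : ℕ) : Fin (s.dM + 1) → Mat n := fun c =>
  (if (c : ℕ) = 0 then s.A else 0) + (if (c : ℕ) = s.dn then s.An else 0) +
    (if (c : ℕ) = l then s.Ad else 0)

/-- `ℒ^⊥(l)`: the row above stacked on an identity matrix. -/
def LPerp {n : ℕ} (s : DelaySystem n) (l : ℕ) : BMat (s.dM + 1 + 1) (s.dM + 1) n :=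
  flat (Matrix.of
    (vecCons (lRow s l) (1 : Matrix (Fin (s.dM + 1)) (Fin (s.dM + 1)) (Mat n))))

/-- `(ℒ^⊥(l))ᵀ (diag(S, 0_n) - diag(0_n, S')) ℒ^⊥(l)`. -/
def crossMat {n : ℕ} (s : DelaySystem n) (S S' : BMat (s.dM + 1) (s.dM + 1) n) (l : ℕ) :
    BMat (s.dM + 1) (s.dM + 1) n :=
  (LPerp s l)ᵀ * (padLast S - padFirst S') * LPerp s l

end DelayLMI

end

/-! Each mode `j` carries a quadratic functional `V_j` of the history, with matrix `calS`, and the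
Lyapunov function is the minimum of `V_1` and `V_2`. In a step of mode `j` the single-mode
inequalities give `V_j(k+1) ≤ V_j(k) - ε‖x(k)‖²`, and the cross-mode inequalities give the same
bound with the other functional on the right. Hence `V_j(k+1)`, and so the minimum at `k+1`, is at
most the minimum at `k` less `ε‖x(k)‖²`. This holds for every switching sequence, because only the
current delay selects `j`. The minimum is continuous, vanishes at zero and dominates `c‖x(k)‖²`,
which gives Lyapunov stability; summing the decrease makes `‖x(k)‖²` summable, which gives
convergence (`asymptoticallyStable_of_functional`).

The cross-mode decrease needs no estimate: the form of `crossMat` is the difference of the two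
functionals (`qf_crossMat`). The single-mode decrease does. By `qf_calS`, `V_j` is a `P`-form of
window sums plus `Q`-weighted sums of states plus ramp-weighted sums of squared increments. One step
turns each ramp sum into a term in the new increment minus a plain sum over a window
(`sum_ramp_shift`, `tailForm_step`). The Wirtinger-based inequality `wirtinger_sum` bounds these
window sums below; the two subwindows cut by the varying delay are merged by `reciprocally_convex`,
which is where `Psi` enters.

The outcome is `qf_calS_step_le`: the increase of `V_j` is at most the form of `Phi` at the extended
vector, which lies in the range of `GammaPerp`. This form is affine in the delay (`qf_Phi_affine`),
so negativity at the two delay bounds suffices. -/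

noncomputable section

namespace DelayLMI

/-! ### Bilinear and quadratic forms of real matrices. -/

variable {ι κ : Type*} [Fintype ι] [Fintype κ]

/-- The bilinear form of a real matrix. -/
def bf (M : Matrix ι κ ℝ) (x : ι → ℝ) (y : κ → ℝ) : ℝ := x ⬝ᵥ M *ᵥ y

/-- The quadratic form of a real square matrix. -/
def qf (M : Matrix ι ι ℝ) (x : ι → ℝ) : ℝ := bf M x x

/-- The vector with the given blocks. -/
def stack {b n : ℕ} (u : Fin b → Fin n → ℝ) : Fin b × Fin n → ℝ := fun p => u p.1 p.2

section bf

variable (M N : Matrix ι κ ℝ) (x x' : ι → ℝ) (y y' : κ → ℝ) (t : ℝ)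

lemma bf_add_left : bf M (x + x') y = bf M x y + bf M x' y := by simp [bf, add_dotProduct]

lemma bf_add_right : bf M x (y + y') = bf M x y + bf M x y' := by
  simp [bf, mulVec_add, dotProduct_add]

lemma bf_sub_left : bf M (x - x') y = bf M x y - bf M x' y := by simp [bf, sub_dotProduct]

lemma bf_sub_right : bf M x (y - y') = bf M x y - bf M x y' := by
  simp [bf, mulVec_sub, dotProduct_sub]

lemma bf_smul_left : bf M (t • x) y = t * bf M x y := by simp [bf, smul_dotProduct]

lemma bf_smul_right : bf M x (t • y) = t * bf M x y := by
  simp [bf, mulVec_smul, dotProduct_smul]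

lemma bf_zero_left : bf M 0 y = 0 := by simp [bf]

lemma bf_zero_right : bf M x 0 = 0 := by simp [bf]

lemma bf_zero_mat : bf (0 : Matrix ι κ ℝ) x y = 0 := by simp [bf]

lemma bf_add_mat : bf (M + N) x y = bf M x y + bf N x y := by
  simp [bf, add_mulVec, dotProduct_add]

lemma bf_sub_mat : bf (M - N) x y = bf M x y - bf N x y := by
  simp [bf, sub_mulVec, dotProduct_sub]

lemma bf_neg_mat : bf (-M) x y = -bf M x y := by simp [bf, neg_mulVec]

lemma bf_smul_mat : bf (t • M) x y = t * bf M x y := by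
  simp [bf, smul_mulVec, dotProduct_smul]

lemma bf_transpose : bf Mᵀ y x = bf M x y := by
  rw [bf, bf, mulVec_transpose, dotProduct_comm, dotProduct_mulVec]

lemma bf_sum_left {α : Type*} (s : Finset α) (f : α → ι → ℝ) :
    bf M (∑ i ∈ s, f i) y = ∑ i ∈ s, bf M (f i) y := by
  simp [bf, sum_dotProduct]

end bf

section qf

variable (M N : Matrix ι ι ℝ) (x y : ι → ℝ) (t : ℝ)

lemma qf_zero_mat : qf (0 : Matrix ι ι ℝ) x = 0 := bf_zero_mat x x

lemma qf_add_mat : qf (M + N) x = qf M x + qf N x := bf_add_mat M N x x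

lemma qf_sub_mat : qf (M - N) x = qf M x - qf N x := bf_sub_mat M N x x

lemma qf_neg_mat : qf (-M) x = -qf M x := bf_neg_mat M x x

lemma qf_smul_mat : qf (t • M) x = t * qf M x := bf_smul_mat M x x t

lemma qf_zero : qf M 0 = 0 := bf_zero_left M 0

lemma qf_smul : qf M (t • x) = t ^ 2 * qf M x := by
  rw [qf, bf_smul_left, bf_smul_right, qf]; ring

lemma qf_conj (W : Matrix ι κ ℝ) (z : κ → ℝ) : qf (Wᵀ * M * W) z = qf M (W *ᵥ z) := by
  simp only [qf, bf]
  rw [← mulVec_mulVec, ← mulVec_mulVec, mulVec_transpose, dotProduct_comm, ← dotProduct_mulVec,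
    dotProduct_comm]

lemma qf_He_conj (W W' : Matrix ι κ ℝ) (z : κ → ℝ) :
    qf (He (Wᵀ * M * W')) z = 2 * bf M (W *ᵥ z) (W' *ᵥ z) := by
  have h : bf (Wᵀ * M * W') z z = bf M (W *ᵥ z) (W' *ᵥ z) := by
    simp only [bf]
    rw [← mulVec_mulVec, ← mulVec_mulVec, mulVec_transpose, dotProduct_comm, ← dotProduct_mulVec,
      dotProduct_comm]
  rw [He, qf_add_mat, qf, qf, bf_transpose, h]; ring

variable {M}

lemma bf_comm_of_posDef (hM : M.PosDef) : bf M x y = bf M y x := by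
  have h : Mᵀ = M := by simpa [IsHermitian, conjTranspose_eq_transpose_of_trivial] using hM.1
  rw [← bf_transpose, h]

lemma qf_nonneg (hM : M.PosDef) : 0 ≤ qf M x := by
  simpa [qf, bf] using hM.posSemidef.dotProduct_mulVec_nonneg x

variable (M) in
lemma continuous_qf : Continuous (qf M) := by
  unfold qf bf; fun_prop

/-- A positive definite form is bounded below by a multiple of the squared norm. -/
lemma exists_qf_lower (hM : M.PosDef) : ∃ c > 0, ∀ x, c * ‖x‖ ^ 2 ≤ qf M x := by
  -- The sphere is empty when the space is zero, a case that occurs for `n = 0`.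
  rcases (Metric.sphere (0 : ι → ℝ) 1).eq_empty_or_nonempty with h | h
  · refine ⟨1, one_pos, fun x => ?_⟩
    have hx : x = 0 := by
      by_contra hx
      have : ‖x‖⁻¹ • x ∈ Metric.sphere (0 : ι → ℝ) 1 := by
        simp [norm_smul, inv_mul_cancel₀ (norm_ne_zero_iff.mpr hx)]
      rw [h] at this; exact this
    simp [hx, qf_zero]
  · obtain ⟨z, hz, hmin⟩ :=
      (isCompact_sphere (0 : ι → ℝ) 1).exists_isMinOn h (continuous_qf M).continuousOn
    have hz0 : z ≠ 0 := by rintro rfl; simp at hz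
    refine ⟨qf M z, by simpa [qf, bf] using hM.dotProduct_mulVec_pos hz0, fun x => ?_⟩
    rcases eq_or_ne x 0 with rfl | hx
    · simp [qf_zero]
    · have hn : ‖x‖ ≠ 0 := norm_ne_zero_iff.mpr hx
      have hmem : ‖x‖⁻¹ • x ∈ Metric.sphere (0 : ι → ℝ) 1 := by
        simp [norm_smul, inv_mul_cancel₀ hn]
      have h1 : qf M z ≤ qf M (‖x‖⁻¹ • x) := hmin hmem
      rw [qf_smul] at h1
      calc qf M z * ‖x‖ ^ 2 ≤ (‖x‖⁻¹ ^ 2 * qf M x) * ‖x‖ ^ 2 := by gcongr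
        _ = qf M x := by field_simp

lemma exists_qf_upper_of_negDef {Y : Matrix ι ι ℝ} (hY : NegDef Y) :
    ∃ c > 0, ∀ x, qf Y x ≤ -(c * ‖x‖ ^ 2) := by
  obtain ⟨c, hc, h⟩ := exists_qf_lower hY
  refine ⟨c, hc, fun x => ?_⟩
  have := h x
  rw [qf_neg_mat] at this
  linarith

end qf

/-! ### Block matrices acting on stacked vectors. -/

section blocks

variable {a b n : ℕ}

lemma flat_mulVec_stack (B : Matrix (Fin a) (Fin b) (Mat n)) (u : Fin b → Fin n → ℝ) :
    flat B *ᵥ stack u = stack fun r => ∑ c, B r c *ᵥ u c := by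
  ext p
  simp only [stack, mulVec, dotProduct, Fintype.sum_prod_type, Finset.sum_apply]
  rfl

lemma bf_stack (M : BMat a b n) (u : Fin a → Fin n → ℝ) (w : Fin b → Fin n → ℝ) :
    bf M (stack u) (stack w)
      = ∑ r, ∑ c, bf (Matrix.of fun i j => M (r, i) (c, j)) (u r) (w c) := by
  simp only [bf, stack, mulVec, dotProduct, Fintype.sum_prod_type, Matrix.of_apply, Finset.mul_sum]
  refine Finset.sum_congr rfl fun r _ => ?_
  rw [Finset.sum_comm]

lemma bf_flat (B : Matrix (Fin a) (Fin b) (Mat n)) (u : Fin a → Fin n → ℝ)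
    (w : Fin b → Fin n → ℝ) :
    bf (flat B) (stack u) (stack w) = ∑ r, ∑ c, bf (B r c) (u r) (w c) := bf_stack _ u w

lemma scal_mulVec_stack (w : Matrix (Fin a) (Fin b) ℝ) (u : Fin b → Fin n → ℝ) :
    scal n w *ᵥ stack u = stack fun r => ∑ c, w r c • u c := by
  rw [scal, flat_mulVec_stack]
  simp [smul_mulVec]

lemma qf_bdiag (D : Fin b → Mat n) (u : Fin b → Fin n → ℝ) :
    qf (bdiag D) (stack u) = ∑ i, qf (D i) (u i) := by
  rw [qf, bdiag, bf_flat]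
  refine Finset.sum_congr rfl fun r _ => ?_
  rw [Finset.sum_eq_single r]
  · simp [qf]
  · intro c _ hc
    simp [diagonal_apply_ne' _ hc, bf_zero_mat]
  · simp

lemma qf_padFirst (S : BMat b b n) (u : Fin (b + 1) → Fin n → ℝ) :
    qf (padFirst S) (stack u) = qf S (stack fun i => u i.succ) := by
  rw [qf, qf, bf_stack, bf_stack]
  simp [Fin.sum_univ_succ, padFirst, bf, mulVec, dotProduct]

lemma qf_padLast (S : BMat b b n) (u : Fin (b + 1) → Fin n → ℝ) :
    qf (padLast S) (stack u) = qf S (stack fun i => u i.castSucc) := by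
  rw [qf, qf, bf_stack, bf_stack]
  simp [Fin.sum_univ_castSucc, padLast, bf, mulVec, dotProduct]

lemma cons_one_mulVec_stack (row : Fin b → Mat n) (u : Fin b → Fin n → ℝ) :
    flat (Matrix.of (vecCons row (1 : Matrix (Fin b) (Fin b) (Mat n)))) *ᵥ stack u
      = stack (vecCons (∑ c, row c *ᵥ u c) u) := by
  rw [flat_mulVec_stack]
  congr 1
  funext r
  refine Fin.cases rfl (fun r => ?_) r
  change ∑ c, (1 : Matrix (Fin b) (Fin b) (Mat n)) r c *ᵥ u c = u r
  rw [Finset.sum_eq_single r]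
  · simp
  · intro c _ hc
    simp [one_apply_ne' hc]
  · simp

/-- Induction on the number of blocks: a new last row and column add one diagonal term and two equal
neighbour terms, since the lower blocks are the transposes of the upper ones. -/
lemma qf_tridiag (m : ℕ) (D O : ℕ → Mat n) (y : ℕ → Fin n → ℝ) :
    qf (tridiag (m + 1) D O) (stack fun i => y i)
      = ∑ i ∈ Finset.range (m + 1), qf (D i) (y i)
        + 2 * ∑ i ∈ Finset.range m, bf (O (i + 1)) (y i) (y (i + 1)) := by
  set F : ℕ → ℕ → ℝ := fun r c => bf (if r = c then D r else if r + 1 = c then O c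
    else if c + 1 = r then (O r)ᵀ else 0) (y r) (y c) with hF
  have key : qf (tridiag (m + 1) D O) (stack fun i => y i)
      = ∑ r ∈ Finset.range (m + 1), ∑ c ∈ Finset.range (m + 1), F r c := by
    rw [qf, tridiag, bf_flat,
      ← Fin.sum_univ_eq_sum_range (fun r => ∑ c ∈ Finset.range (m + 1), F r c)]
    refine Finset.sum_congr rfl fun r _ => ?_
    rw [← Fin.sum_univ_eq_sum_range]
    simp [hF, Fin.ext_iff]
  have hd : ∀ r, F r r = qf (D r) (y r) := fun r => by simp [hF, qf]
  have hu : ∀ r, F r (r + 1) = bf (O (r + 1)) (y r) (y (r + 1)) := fun r => by simp [hF]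
  have hl : ∀ r, F (r + 1) r = bf (O (r + 1)) (y r) (y (r + 1)) := fun r => by
    simp only [hF]
    rw [if_neg (by omega), if_neg (by omega), if_pos trivial, bf_transpose]
  have h0 : ∀ r c, r + 2 ≤ c ∨ c + 2 ≤ r → F r c = 0 := fun r c h => by
    simp only [hF]
    rw [if_neg (by omega), if_neg (by omega), if_neg (by omega), bf_zero_mat]
  rw [key]
  clear key
  induction m with
  | zero => simp [hd]
  | succ m ih =>
    have e1 : ∑ r ∈ Finset.range (m + 1), F r (m + 1)
        = bf (O (m + 1)) (y m) (y (m + 1)) := by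
      rw [Finset.sum_range_succ, hu, Finset.sum_eq_zero, zero_add]
      intro r hr
      exact h0 _ _ (Or.inl (by have := Finset.mem_range.mp hr; omega))
    have e2 : ∑ r ∈ Finset.range (m + 1), F (m + 1) r
        = bf (O (m + 1)) (y m) (y (m + 1)) := by
      rw [Finset.sum_range_succ, hl, Finset.sum_eq_zero, zero_add]
      intro r hr
      exact h0 _ _ (Or.inr (by have := Finset.mem_range.mp hr; omega))
    rw [Finset.sum_range_succ]
    simp_rw [Finset.sum_range_succ _ (m + 1)]
    rw [Finset.sum_add_distrib, ih, e1, e2, hd,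
      Finset.sum_range_succ (fun i => bf (O (i + 1)) (y i) (y (i + 1))) m]
    ring

end blocks

/-! ### Ramp weights and summation by parts. -/

section ramp

/-- Weights that vanish at `0` and beyond `q`, equal `(q - p)²` on `[1, p]` and decrease linearly
on `[p, q]`. -/
def ramp (p q i : ℕ) : ℝ :=
  if i = 0 then 0 else if i ≤ p then ((q : ℝ) - p) ^ 2
  else if i ≤ q then ((q : ℝ) - p) * (q - i + 1) else 0

variable {p q : ℕ}

lemma ramp_zero : ramp p q 0 = 0 := if_pos rfl

lemma ramp_of_lt {i : ℕ} (hpq : p ≤ q) (hi : q < i) : ramp p q i = 0 := by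
  rw [ramp, if_neg (by omega), if_neg (by omega), if_neg (by omega)]

lemma ramp_nonneg (hpq : p ≤ q) (i : ℕ) : 0 ≤ ramp p q i := by
  have h : (p : ℝ) ≤ q := by exact_mod_cast hpq
  unfold ramp
  split_ifs with h1 h2 h3
  · exact le_rfl
  · positivity
  · have h' : (i : ℝ) ≤ q := by exact_mod_cast h3
    exact mul_nonneg (by linarith) (by linarith)
  · exact le_rfl

lemma ramp_one (hpq : p ≤ q) : ramp p q 1 = ((q : ℝ) - p) ^ 2 := by
  unfold ramp
  rcases Nat.eq_zero_or_pos p with rfl | hp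
  · rcases Nat.eq_zero_or_pos q with rfl | hq
    · simp
    · rw [if_neg (by omega), if_neg (by omega), if_pos (by omega)]
      push_cast; ring
  · rw [if_neg (by omega), if_pos (by omega)]

lemma ramp_of_le {i : ℕ} (hi : i + 1 ≤ p) : ramp p q (i + 1) = ((q : ℝ) - p) ^ 2 := by
  rw [ramp, if_neg (by omega), if_pos hi]

/-- Both ends are included: at `i = p` the linear formula continues the plateau, at `i = q` it gives
the zero of the last branch. -/
lemma ramp_of_ge {i : ℕ} (hp : p ≤ i) (hq : i ≤ q) :
    ramp p q (i + 1) = ((q : ℝ) - p) * (q - i) := by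
  rw [ramp, if_neg (by omega), if_neg (by omega)]
  split_ifs with h
  · push_cast; ring
  · obtain rfl : i = q := by omega
    ring

lemma ramp_succ_sub (hpq : p ≤ q) (i : ℕ) :
    ramp p q (i + 2) - ramp p q (i + 1) = if i ∈ Finset.Ico p q then -((q : ℝ) - p) else 0 := by
  simp only [Finset.mem_Ico]
  split_ifs with h
  · rw [ramp_of_ge (by omega : p ≤ i + 1) (by omega), ramp_of_ge h.1 h.2.le]
    push_cast; ring
  · rcases lt_or_ge i p with h1 | h1
    · rw [ramp_of_le (by omega : i + 1 ≤ p)]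
      rcases eq_or_lt_of_le (Nat.succ_le_of_lt h1) with rfl | h2
      · rw [ramp_of_ge (by omega) (by omega)]; push_cast; ring
      · rw [ramp_of_le (by omega)]; ring
    · rw [ramp_of_lt hpq (by omega), ramp_of_lt hpq (by omega), sub_zero]

/-- Telescoping of a sum with ramp weights when the sequence is shifted by one step. -/
lemma sum_ramp_shift (hpq : p ≤ q) {m : ℕ} (hqm : q ≤ m) (g g' : ℕ → ℝ)
    (hg : ∀ i, g' (i + 1) = g i) :
    ∑ i ∈ Finset.range m, ramp p q (i + 1) * g' i - ∑ i ∈ Finset.range m, ramp p q (i + 1) * g i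
      = ((q : ℝ) - p) ^ 2 * g' 0 - ((q : ℝ) - p) * ∑ i ∈ Finset.Ico p q, g i := by
  -- The newest term is split off; the weight at `m + 1 > q` vanishes, so the shifted sum keeps
  -- length `m`.
  have h1 : ∑ i ∈ Finset.range m, ramp p q (i + 1) * g' i
      = ∑ i ∈ Finset.range m, ramp p q (i + 2) * g i + ((q : ℝ) - p) ^ 2 * g' 0 := by
    have := Finset.sum_range_succ' (fun i => ramp p q (i + 1) * g' i) m
    rw [Finset.sum_range_succ, ramp_of_lt hpq (by omega : q < m + 1)] at this
    simpa [ramp_one hpq, hg] using this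
  have h2 : ∑ i ∈ Finset.range m, (ramp p q (i + 2) - ramp p q (i + 1)) * g i
      = -((q : ℝ) - p) * ∑ i ∈ Finset.Ico p q, g i := by
    simp_rw [ramp_succ_sub hpq, ite_mul, zero_mul]
    rw [← Finset.sum_filter, Finset.mul_sum]
    refine Finset.sum_congr ?_ fun _ _ => rfl
    ext i
    simp only [Finset.mem_filter, Finset.mem_range, Finset.mem_Ico]
    omega
  simp_rw [sub_mul, Finset.sum_sub_distrib] at h2
  linarith

/-- Expanding a squared increment contributes its weight to the squares at both of its ends and
minus twice its weight to the neighbour product; the vanishing end weights remove the boundary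
terms. This is the origin of the tridiagonal matrices `calH` and `calHa`. -/
lemma sum_diff_form {n : ℕ} {Z : Mat n} (hZ : Z.PosDef) (m : ℕ) (r : ℕ → ℝ) (h0 : r 0 = 0)
    (hm : r (m + 1) = 0) (y : ℕ → Fin n → ℝ) :
    ∑ i ∈ Finset.range (m + 1), (r i + r (i + 1)) * qf Z (y i)
        - 2 * ∑ i ∈ Finset.range m, r (i + 1) * bf Z (y i) (y (i + 1))
      = ∑ i ∈ Finset.range m, r (i + 1) * qf Z (y i - y (i + 1)) := by
  have e : ∀ i, qf Z (y i - y (i + 1))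
      = qf Z (y i) + qf Z (y (i + 1)) - 2 * bf Z (y i) (y (i + 1)) := by
    intro i
    simp only [qf, bf_sub_left, bf_sub_right]
    rw [bf_comm_of_posDef (y (i + 1)) (y i) hZ]; ring
  simp_rw [e, add_mul, Finset.sum_add_distrib]
  rw [Finset.sum_range_succ' (fun i => r i * qf Z (y i)), Finset.sum_range_succ, h0, hm,
    Finset.mul_sum]
  rw [add_assoc, ← sub_eq_zero]
  simp only [zero_mul, zero_add, add_zero]
  rw [← Finset.sum_add_distrib, ← Finset.sum_sub_distrib, ← Finset.sum_sub_distrib]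
  exact Finset.sum_eq_zero fun _ _ => by ring

end ramp

/-! ### The functionals of the modes as sums over the history. -/

section history

variable {n : ℕ} (s : DelaySystem n) {j : Mode} (v : Vars n j) (y : ℕ → Fin n → ℝ)

/-- Sum of increments weighted by a ramp. -/
def rampSum (m p q : ℕ) (Z : Mat n) (y : ℕ → Fin n → ℝ) : ℝ :=
  ∑ i ∈ Finset.range m, ramp p q (i + 1) * qf Z (y i - y (i + 1))

lemma rampSum_nonneg (m : ℕ) {p q : ℕ} (hpq : p ≤ q) {Z : Mat n} (hZ : Z.PosDef) :
    0 ≤ rampSum m p q Z y :=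
  Finset.sum_nonneg fun _ _ => mul_nonneg (ramp_nonneg hpq _) (qf_nonneg _ hZ)

lemma sum_range_ite (m lo hi : ℕ) (h : hi ≤ m) (f : ℕ → ℝ) :
    ∑ i ∈ Finset.range (m + 1), (if lo < i ∧ i ≤ hi then f i else 0)
      = ∑ i ∈ Finset.Ico (lo + 1) (hi + 1), f i := by
  rw [← Finset.sum_filter]
  refine Finset.sum_congr ?_ fun _ _ => rfl
  ext i
  simp only [Finset.mem_filter, Finset.mem_range, Finset.mem_Ico]
  omega

/-- The `Z`-coefficients of `calH` are sums of two consecutive ramp weights on the diagonal and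
minus a ramp weight beside it, so `sum_diff_form` applies to `Z₁` and `Z₂` separately. -/
lemma qf_calH (hab : s.dmj j ≤ s.dMj j) (hbM : s.dMj j ≤ s.dM) (hZ₁ : v.Z₁.PosDef)
    (hZ₂ : v.Z₂.PosDef) :
    qf (calH s v) (stack fun i => y i)
      = ∑ i ∈ Finset.Ico 1 (s.dmj j + 1), qf v.Q₁ (y i)
        + ∑ i ∈ Finset.Ico (s.dmj j + 1) (s.dMj j + 1), qf v.Q₂ (y i)
        + rampSum s.dM 0 (s.dmj j) v.Z₁ y + rampSum s.dM (s.dmj j) (s.dMj j) v.Z₂ y := by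
  have e1 := sum_diff_form hZ₁ s.dM (ramp 0 (s.dmj j)) ramp_zero
    (ramp_of_lt (by omega) (by omega)) y
  have e2 := sum_diff_form hZ₂ s.dM (ramp (s.dmj j) (s.dMj j)) ramp_zero
    (ramp_of_lt (by omega) (by omega)) y
  have q1 := sum_range_ite s.dM 0 (s.dmj j) (by omega) fun i => qf v.Q₁ (y i)
  have q2 := sum_range_ite s.dM (s.dmj j) (s.dMj j) (by omega) fun i => qf v.Q₂ (y i)
  rw [zero_add] at q1
  rw [rampSum, rampSum, ← e1, ← e2, ← q1, ← q2, calH, chain, qf_tridiag]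
  have hab' : (s.dmj j : ℝ) ≤ s.dMj j := by exact_mod_cast hab
  have hD : ∀ i ∈ Finset.range (s.dM + 1), qf (if i = 0 then
        ((s.dmj j : ℝ) ^ 2 • v.Z₁ + s.dDelta j ^ 2 • v.Z₂)
      else if i ≤ s.dmj j then
        v.Q₁ + (2 * s.dDelta j ^ 2) • v.Z₂ +
          ((s.dmj j : ℝ) * (2 * (s.dmj j : ℝ) - 2 * i + 1)) • v.Z₁
      else if i ≤ s.dMj j then
        v.Q₂ + (s.dDelta j * (2 * s.dDelta j - 2 * ((i - s.dmj j : ℕ) : ℝ) + 1)) • v.Z₂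
      else 0) (y i)
      = (if 0 < i ∧ i ≤ s.dmj j then qf v.Q₁ (y i) else 0)
        + (if s.dmj j < i ∧ i ≤ s.dMj j then qf v.Q₂ (y i) else 0)
        + (ramp 0 (s.dmj j) i + ramp 0 (s.dmj j) (i + 1)) * qf v.Z₁ (y i)
        + (ramp (s.dmj j) (s.dMj j) i + ramp (s.dmj j) (s.dMj j) (i + 1)) * qf v.Z₂ (y i) := by
    intro i _
    rcases i with _ | i
    · simp [ramp_zero, ramp_one hab, ramp_one (Nat.zero_le (s.dmj j)), qf_add_mat, qf_smul_mat,
        DelaySystem.dDelta]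
    rw [if_neg (by omega)]
    split_ifs with h1 h2 h3 h4 h5 h6 <;> try omega
    · rw [ramp_of_ge (by omega) (by omega), ramp_of_ge (by omega) (by omega), ramp_of_le h1]
      -- At the corner of the ramp the next weight belongs to the linear branch but still has the
      -- plateau value.
      have h7 : ramp (s.dmj j) (s.dMj j) (i + 1 + 1) = s.dDelta j ^ 2 := by
        rcases eq_or_lt_of_le h1 with h8 | h8
        · rw [ramp_of_ge (by omega) (by omega), ← h8, DelaySystem.dDelta, ← h8]; ring
        · rw [ramp_of_le (by omega), DelaySystem.dDelta]
      rw [h7]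
      simp only [qf_add_mat, qf_smul_mat, DelaySystem.dDelta]
      push_cast; ring
    · rw [ramp_of_lt (Nat.zero_le _) (by omega), ramp_of_lt (Nat.zero_le _) (by omega),
        ramp_of_ge (by omega) (by omega), ramp_of_ge (by omega) (by omega)]
      simp only [qf_add_mat, qf_smul_mat, DelaySystem.dDelta]
      rw [Nat.cast_sub (by omega)]
      push_cast; ring
    · rw [ramp_of_lt (Nat.zero_le _) (by omega), ramp_of_lt (Nat.zero_le _) (by omega),
        ramp_of_lt hab (by omega), ramp_of_lt hab (by omega), qf_zero_mat]
      ring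
  have hO : ∀ i ∈ Finset.range s.dM, bf (if i + 1 ≤ s.dmj j then
        -(s.dDelta j ^ 2 • v.Z₂) -
          ((s.dmj j : ℝ) * ((s.dmj j : ℝ) - ((i + 1 : ℕ) : ℝ) + 1)) • v.Z₁
      else if i + 1 ≤ s.dMj j then
        -((s.dDelta j * (s.dDelta j - ((i + 1 - s.dmj j : ℕ) : ℝ) + 1)) • v.Z₂)
      else 0) (y i) (y (i + 1))
      = -(ramp 0 (s.dmj j) (i + 1) * bf v.Z₁ (y i) (y (i + 1)))
        - ramp (s.dmj j) (s.dMj j) (i + 1) * bf v.Z₂ (y i) (y (i + 1)) := by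
    intro i _
    split_ifs with h1 h2
    · rw [ramp_of_ge (by omega) (by omega), ramp_of_le h1]
      simp only [bf_sub_mat, bf_neg_mat, bf_smul_mat, DelaySystem.dDelta]
      push_cast; ring
    · rw [ramp_of_lt (Nat.zero_le _) (by omega), ramp_of_ge (by omega) (by omega)]
      simp only [bf_neg_mat, bf_smul_mat, DelaySystem.dDelta]
      rw [Nat.cast_sub (by omega)]
      push_cast; ring
    · rw [ramp_of_lt (Nat.zero_le _) (by omega), ramp_of_lt hab (by omega), bf_zero_mat]
      ring
  rw [Finset.sum_congr rfl hD, Finset.sum_congr rfl hO]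
  simp only [Finset.sum_add_distrib, Finset.sum_sub_distrib, Finset.sum_neg_distrib]
  ring

lemma qf_calHa (hbM : s.dMj j ≤ s.dM) (hZ₃ : v.Z₃.PosDef) :
    qf (calHa s v) (stack fun i => y i) = rampSum s.dM (s.dMj j) s.dM v.Z₃ y := by
  have e := sum_diff_form hZ₃ s.dM (ramp (s.dMj j) s.dM) ramp_zero
    (ramp_of_lt (by omega) (by omega)) y
  rw [rampSum, ← e, calHa, chain, qf_tridiag]
  have hD : ∀ i ∈ Finset.range (s.dM + 1), qf (if i = 0 then s.dDeltaM j ^ 2 • v.Z₃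
      else if i ≤ s.dMj j then (2 * s.dDeltaM j ^ 2) • v.Z₃
      else if i ≤ s.dM then
        (s.dDeltaM j * (2 * s.dDeltaM j - 2 * ((i - s.dMj j : ℕ) : ℝ) + 1)) • v.Z₃
      else 0) (y i)
      = (ramp (s.dMj j) s.dM i + ramp (s.dMj j) s.dM (i + 1)) * qf v.Z₃ (y i) := by
    intro i hi
    have hi := Finset.mem_range.mp hi
    rcases i with _ | i
    · simp [ramp_zero, ramp_one hbM, qf_smul_mat, DelaySystem.dDeltaM]
    rw [if_neg (by omega)]
    split_ifs with h1 h2 <;> try omega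
    · rw [ramp_of_le h1]
      have h7 : ramp (s.dMj j) s.dM (i + 1 + 1) = s.dDeltaM j ^ 2 := by
        rcases eq_or_lt_of_le h1 with h8 | h8
        · rw [ramp_of_ge (by omega) (by omega), ← h8, DelaySystem.dDeltaM, ← h8]; ring
        · rw [ramp_of_le (by omega), DelaySystem.dDeltaM]
      rw [h7]
      simp only [qf_smul_mat, DelaySystem.dDeltaM]
      ring
    · rw [ramp_of_ge (by omega) (by omega), ramp_of_ge (by omega) (by omega)]
      simp only [qf_smul_mat, DelaySystem.dDeltaM]
      rw [Nat.cast_sub (by omega)]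
      push_cast; ring
  have hO : ∀ i ∈ Finset.range s.dM, bf (if i + 1 ≤ s.dMj j then -(s.dDeltaM j ^ 2 • v.Z₃)
      else if i + 1 ≤ s.dM then
        -((s.dDeltaM j * (s.dDeltaM j - ((i + 1 - s.dMj j : ℕ) : ℝ) + 1)) • v.Z₃)
      else 0) (y i) (y (i + 1))
      = -(ramp (s.dMj j) s.dM (i + 1) * bf v.Z₃ (y i) (y (i + 1))) := by
    intro i hi
    have hi := Finset.mem_range.mp hi
    split_ifs with h1 h2 <;> try omega
    · rw [ramp_of_le h1]
      simp only [bf_neg_mat, bf_smul_mat, DelaySystem.dDeltaM]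
    · rw [ramp_of_ge (by omega) (by omega)]
      simp only [bf_neg_mat, bf_smul_mat, DelaySystem.dDeltaM]
      rw [Nat.cast_sub (by omega)]
      push_cast; ring
  rw [Finset.sum_congr rfl hD, Finset.sum_congr rfl hO]
  simp only [Finset.sum_neg_distrib]
  ring

/-- The part of the functional of a mode that does not involve `P`. -/
def tailForm : ℝ :=
  ∑ i ∈ Finset.Ico 1 (s.dmj j + 1), qf v.Q₁ (y i)
    + ∑ i ∈ Finset.Ico (s.dmj j + 1) (s.dMj j + 1), qf v.Q₂ (y i)
    + ∑ i ∈ Finset.Ico (s.dMj j + 1) (s.dM + 1), qf v.Q₃ (y i)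
    + rampSum s.dM 0 (s.dmj j) v.Z₁ y + rampSum s.dM (s.dmj j) (s.dMj j) v.Z₂ y
    + j.e * rampSum s.dM (s.dMj j) s.dM v.Z₃ y

lemma qf_calS (hab : s.dmj j ≤ s.dMj j) (hbM : s.dMj j ≤ s.dM) (hv : v.Positive) :
    qf (calS s v) (stack fun i => y i)
      = qf v.P (stack fun r => ∑ c : Fin (s.dM + 1), w5 s j r c • y c) + tailForm s v y := by
  obtain ⟨-, -, -, -, hZ₁, hZ₂, hZ₃⟩ := hv
  have q3 := sum_range_ite s.dM (s.dMj j) s.dM le_rfl fun i => qf v.Q₃ (y i)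
  have h3 : qf (bdiag fun i : Fin (s.dM + 1) => if s.dMj j < i then v.Q₃ else 0)
      (stack fun i => y i) = ∑ i ∈ Finset.Ico (s.dMj j + 1) (s.dM + 1), qf v.Q₃ (y i) := by
    rw [qf_bdiag, ← q3, ← Fin.sum_univ_eq_sum_range
      (fun i => if s.dMj j < i ∧ i ≤ s.dM then qf v.Q₃ (y i) else 0)]
    refine Finset.sum_congr rfl fun i _ => ?_
    have hi : (i : ℕ) ≤ s.dM := by omega
    by_cases h : s.dMj j < i
    · simp [h, hi]
    · simp [h, qf_zero_mat]
  rw [calS, qf_add_mat, qf_conj, scal_mulVec_stack, calP, qf_add_mat, qf_add_mat, qf_smul_mat,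
    qf_calH s v y hab hbM hZ₁ hZ₂, qf_calHa s v y hbM hZ₃, h3, tailForm]
  ring

lemma mode_e_nonneg : 0 ≤ j.e := by cases j <;> simp [Mode.e]

lemma tailForm_nonneg (hab : s.dmj j ≤ s.dMj j) (hbM : s.dMj j ≤ s.dM) (hv : v.Positive) :
    0 ≤ tailForm s v y := by
  obtain ⟨-, hQ₁, hQ₂, hQ₃, hZ₁, hZ₂, hZ₃⟩ := hv
  have h1 := rampSum_nonneg y s.dM (Nat.zero_le (s.dmj j)) hZ₁
  have h2 := rampSum_nonneg y s.dM hab hZ₂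
  have h3 := mul_nonneg (mode_e_nonneg (j := j)) (rampSum_nonneg y s.dM hbM hZ₃)
  have q : ∀ {Q : Mat n}, Q.PosDef → ∀ t : Finset ℕ, 0 ≤ ∑ i ∈ t, qf Q (y i) :=
    fun hQ t => Finset.sum_nonneg fun i _ => qf_nonneg _ hQ
  have := q hQ₁ (Finset.Ico 1 (s.dmj j + 1))
  have := q hQ₂ (Finset.Ico (s.dmj j + 1) (s.dMj j + 1))
  have := q hQ₃ (Finset.Ico (s.dMj j + 1) (s.dM + 1))
  unfold tailForm
  linarith

lemma norm_le_norm_stack {b : ℕ} (u : Fin b → Fin n → ℝ) (r : Fin b) : ‖u r‖ ≤ ‖stack u‖ :=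
  (pi_norm_le_iff_of_nonneg (norm_nonneg _)).mpr fun i => norm_le_pi_norm (stack u) (r, i)

lemma norm_stack_lt {b : ℕ} (u : Fin b → Fin n → ℝ) {δ : ℝ} (hδ : 0 < δ)
    (h : ∀ r, ‖u r‖ < δ) : ‖stack u‖ < δ :=
  (pi_norm_lt_iff hδ).mpr fun p => (norm_le_pi_norm (u p.1) p.2).trans_lt (h p.1)

/-- The functional of a mode bounds the current state. -/
lemma exists_qf_calS_lower (hab : s.dmj j ≤ s.dMj j) (hbM : s.dMj j ≤ s.dM) (hv : v.Positive) :
    ∃ c > 0, ∀ y : ℕ → Fin n → ℝ, c * ‖y 0‖ ^ 2 ≤ qf (calS s v) (stack fun i => y i) := by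
  obtain ⟨c, hc, h⟩ := exists_qf_lower hv.1
  refine ⟨c, hc, fun y => ?_⟩
  rw [qf_calS s v y hab hbM hv]
  have h1 := h (stack fun r => ∑ c : Fin (s.dM + 1), w5 s j r c • y c)
  have h2 := tailForm_nonneg s v y hab hbM hv
  -- The first block row of `w5` selects the current state, so `y 0` is a block of the argument of
  -- `P`.
  have h3 : ‖y 0‖ ≤ ‖stack fun r => ∑ c : Fin (s.dM + 1), w5 s j r c • y c‖ := by
    have h0 : 0 < j.rows := by cases j <;> simp
    convert norm_le_norm_stack (fun r => ∑ c : Fin (s.dM + 1), w5 s j r c • y c) ⟨0, h0⟩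
    rw [Finset.sum_eq_single 0]
    · simp [w5]
    · intro c _ hc
      simp [w5, hc]
    · simp
  calc c * ‖y 0‖ ^ 2
      ≤ c * ‖stack fun r => ∑ c : Fin (s.dM + 1), w5 s j r c • y c‖ ^ 2 := by gcongr
    _ ≤ _ := by linarith

lemma sum_Ico_shift {G : Type*} [AddCommGroup G] (f g : ℕ → G) (h : ∀ i, g (i + 1) = f i) {p q : ℕ}
    (hpq : p ≤ q) :
    ∑ i ∈ Finset.Ico (p + 1) (q + 1), g i - ∑ i ∈ Finset.Ico (p + 1) (q + 1), f i
      = f p - f q := by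
  induction q, hpq using Nat.le_induction with
  | base => simp
  | succ q hpq ih =>
    rw [Finset.sum_Ico_succ_top (by omega : p + 1 ≤ q + 1) g,
      Finset.sum_Ico_succ_top (by omega : p + 1 ≤ q + 1) f, h, add_sub_add_comm, ih]
    abel

/-- Change of the part of the functional without `P` when one step `z` is prepended. -/
lemma tailForm_step (hab : s.dmj j ≤ s.dMj j) (hbM : s.dMj j ≤ s.dM) (y' : ℕ → Fin n → ℝ)
    (hy : ∀ i, y' (i + 1) = y i) :
    tailForm s v y' - tailForm s v y
      = qf v.Q₁ (y 0) - qf v.Q₁ (y (s.dmj j)) + (qf v.Q₂ (y (s.dmj j)) - qf v.Q₂ (y (s.dMj j)))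
        + (qf v.Q₃ (y (s.dMj j)) - qf v.Q₃ (y s.dM))
        + (s.dmj j : ℝ) ^ 2 * qf v.Z₁ (y' 0 - y 0) + s.dDelta j ^ 2 * qf v.Z₂ (y' 0 - y 0)
        + j.e * s.dDeltaM j ^ 2 * qf v.Z₃ (y' 0 - y 0)
        - (s.dmj j : ℝ) * ∑ i ∈ Finset.Ico 0 (s.dmj j), qf v.Z₁ (y i - y (i + 1))
        - s.dDelta j * ∑ i ∈ Finset.Ico (s.dmj j) (s.dMj j), qf v.Z₂ (y i - y (i + 1))
        - j.e * (s.dDeltaM j * ∑ i ∈ Finset.Ico (s.dMj j) s.dM, qf v.Z₃ (y i - y (i + 1))) := by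
  have q : ∀ Q : Mat n, ∀ {p q : ℕ}, p ≤ q → _ := fun Q {p q} h =>
    sum_Ico_shift (fun i => qf Q (y i)) (fun i => qf Q (y' i)) (fun i => by rw [hy]) h
  have z : ∀ Z : Mat n, ∀ {p q : ℕ}, p ≤ q → q ≤ s.dM → _ := fun Z {p q} h h' =>
    sum_ramp_shift h h' (fun i => qf Z (y i - y (i + 1))) (fun i => qf Z (y' i - y' (i + 1)))
      (fun i => by rw [hy, hy])
  have q1 := q v.Q₁ (Nat.zero_le (s.dmj j))
  have q2 := q v.Q₂ hab
  have q3 := q v.Q₃ hbM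
  have z1 := z v.Z₁ (Nat.zero_le (s.dmj j)) (hab.trans hbM)
  have z2 := z v.Z₂ hab hbM
  have z3 := z v.Z₃ hbM le_rfl
  simp only [hy, zero_add, Nat.cast_zero, sub_zero] at q1 q2 q3 z1 z2 z3
  simp only [tailForm, rampSum, DelaySystem.dDelta, DelaySystem.dDeltaM]
  have r : ∀ i, y' i - y' (i + 1) = y' i - y i := fun i => by rw [hy]
  simp only [r]
  linear_combination q1 + q2 + q3 + z1 + z2 + j.e * z3

end history

/-! ### Wirtinger-based summation inequality and reciprocally convex combination. -/

section summation_inequality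

variable {n : ℕ} {Z : Mat n}

/-- Abel summation; it evaluates the linear moment of the increments in `bessel_increments`. -/
lemma sum_succ_smul_diff {V : Type*} [AddCommGroup V] [Module ℝ V] (y : ℕ → V) (N : ℕ) :
    ∑ i ∈ Finset.range N, ((i : ℝ) + 1) • (y i - y (i + 1))
      = ∑ i ∈ Finset.range (N + 1), y i - ((N : ℝ) + 1) • y N := by
  induction N with
  | zero => simp
  | succ N ih =>
    rw [Finset.sum_range_succ, ih, Finset.sum_range_succ _ (N + 1)]
    push_cast
    module

lemma sum_range_sub_two_mul (c : ℝ) (m : ℕ) :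
    ∑ i ∈ Finset.range m, (c - 2 * i) = m * c - m * (m - 1) := by
  induction m with
  | zero => simp
  | succ m ih => rw [Finset.sum_range_succ, ih]; push_cast; ring

lemma sum_range_sub_two_mul_sq (c : ℝ) (m : ℕ) :
    ∑ i ∈ Finset.range m, (c - 2 * i) ^ 2
      = m * c ^ 2 - 2 * c * m * (m - 1) + 2 * m * (m - 1) * (2 * m - 1) / 3 := by
  induction m with
  | zero => simp
  | succ m ih => rw [Finset.sum_range_succ, ih]; push_cast; ring

/-- Bessel-type inequality for the first two discrete orthogonal polynomials. -/
lemma bessel_increments (hZ : Z.PosDef) (y : ℕ → Fin n → ℝ) (N : ℕ) (s t : ℝ) :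
    0 ≤ ∑ i ∈ Finset.range N, qf Z (y i - y (i + 1))
      + (N * s ^ 2 - 2 * s) * qf Z (y 0 - y N)
      + (N * ((N : ℝ) ^ 2 - 1) / 3 * t ^ 2 - 2 * t) *
        qf Z (((N : ℝ) + 1) • (y 0 + y N) - (2 : ℝ) • ∑ i ∈ Finset.range (N + 1), y i) := by
  -- `β` is the discrete linear polynomial orthogonal to constants (`f2`), and `Θ`, `R` are the
  -- moments of the increments against `1` and `β`. The claim is that the squared residuals of a
  -- linear fit, with free coefficients `s` and `t`, have nonnegative sum.
  set η : ℕ → Fin n → ℝ := fun i => y i - y (i + 1) with hη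
  set β : ℕ → ℝ := fun i => ((N : ℝ) - 1) - 2 * i with hβ
  set R := ((N : ℝ) + 1) • (y 0 + y N) - (2 : ℝ) • ∑ i ∈ Finset.range (N + 1), y i with hR
  set Θ := y 0 - y N with hΘ
  have f0 : ∑ i ∈ Finset.range N, η i = Θ := Finset.sum_range_sub' y N
  have f1 : ∑ i ∈ Finset.range N, β i • η i = R := by
    have h := sum_succ_smul_diff y N
    have e : ∀ i, β i • η i
        = ((N : ℝ) + 1) • η i - (2 : ℝ) • (((i : ℝ) + 1) • (y i - y (i + 1))) := fun i => by
      simp only [hβ, hη]; module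
    simp_rw [e, Finset.sum_sub_distrib, ← Finset.smul_sum]
    rw [h, f0, hR, hΘ]
    module
  have f2 : ∑ i ∈ Finset.range N, β i = 0 := by
    rw [sum_range_sub_two_mul]; ring
  have f3 : ∑ i ∈ Finset.range N, β i ^ 2 = N * ((N : ℝ) ^ 2 - 1) / 3 := by
    rw [sum_range_sub_two_mul_sq]; ring
  have e : ∀ i, qf Z (η i - s • Θ - (t * β i) • R)
      = qf Z (η i) - 2 * s * bf Z (η i) Θ - 2 * t * bf Z (β i • η i) R + s ^ 2 * qf Z Θ
        + 2 * s * t * bf Z Θ R * β i + t ^ 2 * qf Z R * β i ^ 2 := fun i => by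
    simp only [qf, bf_sub_left, bf_sub_right, bf_smul_left, bf_smul_right]
    rw [bf_comm_of_posDef Θ (η i) hZ, bf_comm_of_posDef R (η i) hZ, bf_comm_of_posDef R Θ hZ]
    ring
  have h : 0 ≤ ∑ i ∈ Finset.range N, qf Z (η i - s • Θ - (t * β i) • R) :=
    Finset.sum_nonneg fun i _ => qf_nonneg _ hZ
  simp_rw [e, Finset.sum_add_distrib, Finset.sum_sub_distrib, ← Finset.mul_sum, ← bf_sum_left,
    f0, f1, f2, f3] at h
  simp only [Finset.sum_const, Finset.card_range, nsmul_eq_mul] at h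
  have hb : bf Z Θ Θ = qf Z Θ := rfl
  have hb' : bf Z R R = qf Z R := rfl
  rw [hb, hb'] at h
  linarith

/-- The Wirtinger-based summation inequality. -/
lemma wirtinger_sum (hZ : Z.PosDef) (y : ℕ → Fin n → ℝ) {N : ℕ} (hN : 1 ≤ N) (w : Fin n → ℝ)
    (hw : ((N : ℝ) + 1) • w = ∑ i ∈ Finset.range (N + 1), y i) :
    qf Z (y 0 - y N) + 3 * gam N * qf Z (y 0 + y N - (2 : ℝ) • w)
      ≤ N * ∑ i ∈ Finset.range N, qf Z (y i - y (i + 1)) := by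
  have hR : ((N : ℝ) + 1) • (y 0 + y N) - (2 : ℝ) • ∑ i ∈ Finset.range (N + 1), y i
      = ((N : ℝ) + 1) • (y 0 + y N - (2 : ℝ) • w) := by rw [← hw]; module
  rcases eq_or_lt_of_le hN with rfl | hN
  -- With a single increment `w` is the midpoint, so the second term vanishes whatever the value of
  -- `gam 1`.
  · have : y 0 + y 1 - (2 : ℝ) • w = 0 := by
      have h2 : (2 : ℝ) • w = y 0 + y 1 := by
        rw [Finset.sum_range_succ, Finset.sum_range_one] at hw
        rw [← hw]; norm_num
      rw [h2, sub_self]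
    rw [this, qf_zero]
    simp
  · have hN' : (2 : ℝ) ≤ N := by exact_mod_cast hN
    -- These values minimise the two quadratic coefficients, with minima `-1/N` and `-3/(N(N²-1))`.
    -- The factor `(N+1)²` coming from `hR` and the multiplication by `N` turn the second into
    -- `-3(N+1)/(N-1)`, that is `-3 * gam N`.
    have h := bessel_increments hZ y N (1 / N) (3 / (N * ((N : ℝ) ^ 2 - 1)))
    rw [hR, qf_smul] at h
    have h1 : (N : ℝ) - 1 ≠ 0 := by linarith
    have h2 : (N : ℝ) + 1 ≠ 0 := by linarith
    have h0 : (N : ℝ) ≠ 0 := by linarith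
    have h3 : (N : ℝ) ^ 2 - 1 ≠ 0 := by
      have : (N : ℝ) ^ 2 - 1 = (N - 1) * (N + 1) := by ring
      rw [this]; exact mul_ne_zero h1 h2
    have c1 : (N : ℝ) * (1 / N) ^ 2 - 2 * (1 / N) = -(1 / N) := by field_simp; ring
    have c2 : (N : ℝ) * ((N : ℝ) ^ 2 - 1) / 3 * (3 / (N * ((N : ℝ) ^ 2 - 1))) ^ 2
        - 2 * (3 / (N * ((N : ℝ) ^ 2 - 1))) = -(3 / (N * ((N : ℝ) ^ 2 - 1))) := by
      field_simp; ring
    rw [c1, c2] at h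
    have h4 := mul_nonneg (by linarith : (0 : ℝ) ≤ N) h
    rw [gam, if_neg (by omega)]
    have e : (N : ℝ) * (∑ i ∈ Finset.range N, qf Z (y i - y (i + 1)) + -(1 / N) * qf Z (y 0 - y N)
        + -(3 / (N * ((N : ℝ) ^ 2 - 1))) *
          (((N : ℝ) + 1) ^ 2 * qf Z (y 0 + y N - (2 : ℝ) • w)))
        = N * ∑ i ∈ Finset.range N, qf Z (y i - y (i + 1)) - (qf Z (y 0 - y N)
          + 3 * (((N : ℝ) + 1) / (N - 1)) * qf Z (y 0 + y N - (2 : ℝ) • w)) := by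
      have h5 : 3 / (N * ((N : ℝ) ^ 2 - 1)) = 3 / (N * ((N - 1) * (N + 1))) := by
        congr 2; ring
      rw [h5]
      field_simp
      ring
    linarith

lemma one_le_gam {N : ℕ} (hN : 1 ≤ N) : 1 ≤ gam N := by
  unfold gam
  split_ifs with h
  · exact le_rfl
  · have : (2 : ℝ) ≤ N := by exact_mod_cast (by omega : 2 ≤ N)
    rw [le_div_iff₀ (by linarith)]
    linarith

/-- Average of `y p, …, y q`. -/
def avg (p q : ℕ) (y : ℕ → Fin n → ℝ) : Fin n → ℝ :=
  ((q : ℝ) - p + 1)⁻¹ • ∑ i ∈ Finset.Ico p (q + 1), y i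

lemma smul_avg {p q : ℕ} (hpq : p ≤ q) (y : ℕ → Fin n → ℝ) :
    ((q : ℝ) - p + 1) • avg p q y = ∑ i ∈ Finset.Ico p (q + 1), y i := by
  have h : (p : ℝ) ≤ q := by exact_mod_cast hpq
  rw [avg, smul_smul, mul_inv_cancel₀ (by linarith), one_smul]

lemma avg_self (p : ℕ) (y : ℕ → Fin n → ℝ) : avg p p y = y p := by simp [avg]

lemma wirtinger_window_zero (hZ : Z.PosDef) (y : ℕ → Fin n → ℝ) {q : ℕ} (hq : 1 ≤ q) :
    qf Z (y 0 - y q) + 3 * gam q * qf Z (y 0 + y q - (2 : ℝ) • avg 0 q y)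
      ≤ q * ∑ i ∈ Finset.Ico 0 q, qf Z (y i - y (i + 1)) := by
  have h := smul_avg (Nat.zero_le q) y
  rw [Nat.cast_zero, sub_zero, ← Finset.range_eq_Ico] at h
  rw [← Finset.range_eq_Ico]
  exact wirtinger_sum hZ y hq _ h

/-- Lowering `gam` to `1` makes the coefficients independent of the window length, as needed when
one end is the varying delay; windows of length zero are then covered as well. -/
lemma wirtinger_window (hZ : Z.PosDef) (y : ℕ → Fin n → ℝ) {p q : ℕ} (hpq : p ≤ q) :
    qf Z (y p - y q) + 3 * qf Z (y p + y q - (2 : ℝ) • avg p q y)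
      ≤ ((q : ℝ) - p) * ∑ i ∈ Finset.Ico p q, qf Z (y i - y (i + 1)) := by
  obtain ⟨N, rfl⟩ := Nat.exists_eq_add_of_le hpq
  rcases Nat.eq_zero_or_pos N with rfl | hN
  · have : y p + y p - (2 : ℝ) • y p = 0 := by module
    simp [avg_self, this, qf_zero]
  · have h := smul_avg hpq y
    rw [add_assoc, Finset.sum_Ico_eq_sum_range] at h
    have h' := wirtinger_sum hZ (fun i => y (p + i)) hN (avg p (p + N) y) (by
      convert h using 2
      · push_cast; ring
      · congr 1; omega)
    have g := mul_le_mul_of_nonneg_right (one_le_gam hN)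
      (qf_nonneg (y p + y (p + N) - (2 : ℝ) • avg p (p + N) y) hZ)
    rw [Finset.sum_Ico_eq_sum_range]
    simp only [add_zero] at h'
    have e1 : ((p + N : ℕ) : ℝ) - p = N := by push_cast; ring
    have e2 : p + N - p = N := by omega
    rw [e1, e2]
    simp only [add_assoc] at h' ⊢
    linarith

/-- Two-block quadratic form. -/
lemma qf_fromBlocks {ι κ : Type*} [Fintype ι] [Fintype κ] (A : Matrix ι ι ℝ) (B : Matrix ι κ ℝ)
    (D : Matrix κ κ ℝ) (t : ι → ℝ) (b : κ → ℝ) :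
    qf (fromBlocks A B Bᵀ D) (Sum.elim t b) = qf A t + qf D b + 2 * bf B t b := by
  have h : bf (fromBlocks A B Bᵀ D) (Sum.elim t b) (Sum.elim t b)
      = bf A t t + bf B t b + (bf Bᵀ b t + bf D b b) := by
    simp [bf, fromBlocks_mulVec, dotProduct_add]
  rw [qf, h, bf_transpose, qf, qf]
  ring

/-- The reciprocally convex combination lemma. -/
lemma reciprocally_convex {ι : Type*} [Fintype ι] {A B : Matrix ι ι ℝ}
    (h : (fromBlocks A B Bᵀ A).PosDef) (t b : ι → ℝ) {p r σ τ : ℝ} (hp : 0 ≤ p) (hr : 0 ≤ r)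
    (hb : qf A b ≤ p * σ) (ht : qf A t ≤ r * τ) (hp0 : p = 0 → σ = 0 ∧ b = 0)
    (hr0 : r = 0 → τ = 0 ∧ t = 0) :
    qf (fromBlocks A B Bᵀ A) (Sum.elim t b) ≤ (p + r) * (σ + τ) := by
  rw [qf_fromBlocks]
  -- A window of length zero contributes neither increments nor a vector, and the bound for the
  -- other window alone suffices.
  rcases hp.eq_or_lt with hp' | hp'
  · obtain ⟨rfl, rfl⟩ := hp0 hp'.symm
    rw [← hp', bf_zero_right, qf_zero]
    linarith
  rcases hr.eq_or_lt with hr' | hr'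
  · obtain ⟨rfl, rfl⟩ := hr0 hr'.symm
    rw [← hr', bf_zero_left, qf_zero]
    linarith
  -- With this test vector, the two bounds and division by `p * r` yield `2 * bf B t b ≤ p * τ + r *
  -- σ`, exactly the mixed terms of `(p + r) * (σ + τ)`.
  have key := qf_nonneg (Sum.elim (p • t) ((-r) • b)) h
  rw [qf_fromBlocks, qf_smul, qf_smul, bf_smul_left, bf_smul_right] at key
  have h1 : p ^ 2 * qf A t ≤ p ^ 2 * (r * τ) := by gcongr
  have h2 : r ^ 2 * qf A b ≤ r ^ 2 * (p * σ) := by gcongr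
  have h3 : 0 ≤ (p * r) * (p * τ + r * σ - 2 * bf B t b) := by linarith
  have h4 := nonneg_of_mul_nonneg_right h3 (mul_pos hp' hr')
  linarith

end summation_inequality

/-! ### The extended vector and the one-step estimate within a mode. -/

section extended_vector

variable {n : ℕ} (s : DelaySystem n)

/-- The extended vector of a mode without its first block: delayed states and window averages. -/
def delayVec : (j : Mode) → ℕ → (ℕ → Fin n → ℝ) → Fin j.cols → Fin n → ℝ
  | .one, d, y => ![y 0, y s.dm, y d, y s.dn, avg 0 s.dm y, avg s.dm d y, avg d s.dn y, y s.dM,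
      avg s.dn s.dM y]
  | .two, d, y => ![y 0, y s.dn, y d, y s.dM, avg 0 s.dn y, avg s.dn d y, avg d s.dM y]

/-- The extended vector of a mode. -/
def extVec : (j : Mode) → ℕ → (Fin n → ℝ) → (ℕ → Fin n → ℝ) → Fin (j.cols + 1) → Fin n → ℝ
  | .one, d, z, y => ![z, y 0, y s.dm, y d, y s.dn, avg 0 s.dm y, avg s.dm d y, avg d s.dn y,
      y s.dM, avg s.dn s.dM y]
  | .two, d, z, y => ![z, y 0, y s.dn, y d, y s.dM, avg 0 s.dn y, avg s.dn d y, avg d s.dM y]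

lemma extVec_eq_cons (j : Mode) (d : ℕ) (z : Fin n → ℝ) (y : ℕ → Fin n → ℝ) :
    extVec s j d z y = vecCons z (delayVec s j d y) := by
  cases j <;> rfl

/-- The state followed by the sums of past states over the windows of a mode. -/
def windowSums : (j : Mode) → (ℕ → Fin n → ℝ) → Fin j.rows → Fin n → ℝ
  | .one, y => ![y 0, ∑ i ∈ Finset.Ico 1 (s.dm + 1), y i,
      ∑ i ∈ Finset.Ico (s.dm + 1) (s.dn + 1), y i, ∑ i ∈ Finset.Ico (s.dn + 1) (s.dM + 1), y i]
  | .two, y => ![y 0, ∑ i ∈ Finset.Ico 1 (s.dn + 1), y i,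
      ∑ i ∈ Finset.Ico (s.dn + 1) (s.dM + 1), y i]

lemma sum_fin_ite_smul (m lo hi : ℕ) (h : hi ≤ m) (y : ℕ → Fin n → ℝ) (p : ℕ → Prop)
    [DecidablePred p] (hp : ∀ i ≤ m, p i ↔ lo + 1 ≤ i ∧ i ≤ hi) :
    ∑ c : Fin (m + 1), (if p c then (1 : ℝ) else 0) • y c
      = ∑ i ∈ Finset.Ico (lo + 1) (hi + 1), y i := by
  rw [Fin.sum_univ_eq_sum_range (fun i => (if p i then (1 : ℝ) else 0) • y i)]
  simp_rw [ite_smul, one_smul, zero_smul]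
  rw [← Finset.sum_filter]
  refine Finset.sum_congr ?_ fun _ _ => rfl
  ext i
  simp only [Finset.mem_filter, Finset.mem_range, Finset.mem_Ico]
  constructor
  · rintro ⟨h1, h2⟩
    have := (hp i (by omega)).1 h2
    omega
  · rintro ⟨h1, h2⟩
    exact ⟨by omega, (hp i (by omega)).2 (by omega)⟩

lemma sum_fin_zero_smul (m : ℕ) (y : ℕ → Fin n → ℝ) :
    ∑ c : Fin (m + 1), (if (c : ℕ) = 0 then (1 : ℝ) else 0) • y c = y 0 := by
  rw [Finset.sum_eq_single 0]
  · simp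
  · intro c _ hc
    simp [hc]
  · simp

lemma w5_rows (hmn : s.dm ≤ s.dn) (hnM : s.dn ≤ s.dM) (j : Mode) (y : ℕ → Fin n → ℝ) :
    (fun r => ∑ c : Fin (s.dM + 1), w5 s j r c • y c) = windowSums s j y := by
  cases j
  · funext r
    fin_cases r
    · exact sum_fin_zero_smul s.dM y
    · exact sum_fin_ite_smul s.dM 0 s.dm (by omega) y (fun i => 1 ≤ i ∧ i ≤ s.dm) (by omega)
    · exact sum_fin_ite_smul s.dM s.dm s.dn (by omega) y (fun i => s.dm < i ∧ i ≤ s.dn) (by omega)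
    · exact sum_fin_ite_smul s.dM s.dn s.dM (by omega) y (fun i => s.dn < i) (by omega)
  · funext r
    fin_cases r
    · exact sum_fin_zero_smul s.dM y
    · exact sum_fin_ite_smul s.dM 0 s.dn (by omega) y (fun i => 1 ≤ i ∧ i ≤ s.dn) (by omega)
    · exact sum_fin_ite_smul s.dM s.dn s.dM (by omega) y (fun i => s.dn < i ∧ i ≤ s.dM) (by omega)

lemma sum_Ico_window {V : Type*} [AddCommGroup V] (y : ℕ → V) {p q : ℕ} (hpq : p ≤ q) :
    ∑ i ∈ Finset.Ico p q, y i = ∑ i ∈ Finset.range q, y i - ∑ i ∈ Finset.range p, y i :=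
  Finset.sum_Ico_eq_sub _ hpq

lemma sum_Ico_prepend {V : Type*} [AddCommGroup V] (y y' : ℕ → V) (hy : ∀ i, y' (i + 1) = y i)
    {p q : ℕ} (hpq : p ≤ q) :
    ∑ i ∈ Finset.Ico (p + 1) (q + 1), y' i
      = ∑ i ∈ Finset.range q, y i - ∑ i ∈ Finset.range p, y i := by
  rw [← Finset.sum_Ico_add' y' p q 1, ← Finset.sum_Ico_eq_sub _ hpq]
  simp_rw [hy]

/-- `(W₁ + W(d)) ξ` is the vector of window sums before the step. -/
lemma w1_rows (hmn : s.dm ≤ s.dn) (hnM : s.dn ≤ s.dM) (j : Mode) {d : ℕ} (hd : s.dmj j ≤ d)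
    (hd' : d ≤ s.dMj j) (z : Fin n → ℝ) (y : ℕ → Fin n → ℝ) :
    (fun r => ∑ c, (w1 j (s.dmj j) (s.dMj j) (s.dDeltaM j) + w j d) r c • extVec s j d z y c)
      = windowSums s j y := by
  cases j
  · simp only [DelaySystem.dmj, DelaySystem.dMj, DelaySystem.dDeltaM] at *
    have a1 := smul_avg (Nat.zero_le s.dm) y
    have a2 := smul_avg hd y
    have a3 := smul_avg hd' y
    have a4 := smul_avg hnM y
    rw [sum_Ico_window y (by omega)] at a1 a2 a3 a4
    simp only [Finset.sum_range_succ, Finset.sum_range_zero, Nat.cast_zero] at a1 a2 a3 a4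
    funext r
    fin_cases r
    · simp [Fin.sum_univ_succ, w1, w, extVec, windowSums]
    · simp [Fin.sum_univ_succ, w1, w, extVec, windowSums]
      rw [sum_Ico_window y (by omega), Finset.sum_range_succ, Finset.sum_range_succ]
      simp only [Finset.sum_range_zero]
      linear_combination (norm := module) a1
    -- `w` corrects the factors of the two averages to the lengths of `[d_m, d]` and `[d, d_n]`.
    -- These windows share the index `d`; removing one copy of `y d` and the state at `d_m` leaves
    -- the window `(d_m, d_n]`.
    · simp [Fin.sum_univ_succ, w1, w, extVec, windowSums]
      rw [sum_Ico_window y (by omega), Finset.sum_range_succ, Finset.sum_range_succ]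
      linear_combination (norm := module) a2 + a3
    · simp [Fin.sum_univ_succ, w1, w, extVec, windowSums]
      rw [sum_Ico_window y (by omega), Finset.sum_range_succ, Finset.sum_range_succ]
      linear_combination (norm := module) a4
  · simp only [DelaySystem.dmj, DelaySystem.dMj, DelaySystem.dDeltaM] at *
    have a1 := smul_avg (Nat.zero_le s.dn) y
    have a2 := smul_avg hd y
    have a3 := smul_avg hd' y
    rw [sum_Ico_window y (by omega)] at a1 a2 a3
    simp only [Finset.sum_range_succ, Finset.sum_range_zero, Nat.cast_zero] at a1 a2 a3
    funext r
    fin_cases r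
    · simp [Fin.sum_univ_succ, w1, w, extVec, windowSums]
    · simp [Fin.sum_univ_succ, w1, w, extVec, windowSums]
      rw [sum_Ico_window y (by omega), Finset.sum_range_succ, Finset.sum_range_succ]
      simp only [Finset.sum_range_zero]
      linear_combination (norm := module) a1
    · simp [Fin.sum_univ_succ, w1, w, extVec, windowSums]
      rw [sum_Ico_window y (by omega), Finset.sum_range_succ, Finset.sum_range_succ]
      linear_combination (norm := module) a2 + a3

/-- `(W₂ + W(d)) ξ` is the vector of window sums after the step. -/
lemma w2_rows (hmn : s.dm ≤ s.dn) (hnM : s.dn ≤ s.dM) (j : Mode) {d : ℕ} (hd : s.dmj j ≤ d)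
    (hd' : d ≤ s.dMj j) (y y' : ℕ → Fin n → ℝ) (hy : ∀ i, y' (i + 1) = y i) :
    (fun r => ∑ c, (w2 j (s.dmj j) (s.dMj j) (s.dDeltaM j) + w j d) r c • extVec s j d (y' 0) y c)
      = windowSums s j y' := by
  cases j
  · simp only [DelaySystem.dmj, DelaySystem.dMj, DelaySystem.dDeltaM] at *
    have a1 := smul_avg (Nat.zero_le s.dm) y
    have a2 := smul_avg hd y
    have a3 := smul_avg hd' y
    have a4 := smul_avg hnM y
    rw [sum_Ico_window y (by omega)] at a1 a2 a3 a4
    simp only [Finset.sum_range_succ, Finset.sum_range_zero, Nat.cast_zero] at a1 a2 a3 a4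
    funext r
    fin_cases r
    · simp [Fin.sum_univ_succ, w2, w, extVec, windowSums]
    · simp [Fin.sum_univ_succ, w2, w, extVec, windowSums]
      rw [sum_Ico_prepend y y' hy (Nat.zero_le _)]
      simp only [Finset.sum_range_zero]
      linear_combination (norm := module) a1
    -- After the step the window covers the old indices `[d_m, d_n)`, so the state at `d_n` is
    -- removed instead of the one at `d_m`.
    · simp [Fin.sum_univ_succ, w2, w, extVec, windowSums]
      rw [sum_Ico_prepend y y' hy (by omega)]
      linear_combination (norm := module) a2 + a3
    · simp [Fin.sum_univ_succ, w2, w, extVec, windowSums]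
      rw [sum_Ico_prepend y y' hy (by omega)]
      linear_combination (norm := module) a4
  · simp only [DelaySystem.dmj, DelaySystem.dMj, DelaySystem.dDeltaM] at *
    have a1 := smul_avg (Nat.zero_le s.dn) y
    have a2 := smul_avg hd y
    have a3 := smul_avg hd' y
    rw [sum_Ico_window y (by omega)] at a1 a2 a3
    simp only [Finset.sum_range_succ, Finset.sum_range_zero, Nat.cast_zero] at a1 a2 a3
    funext r
    fin_cases r
    · simp [Fin.sum_univ_succ, w2, w, extVec, windowSums]
    · simp [Fin.sum_univ_succ, w2, w, extVec, windowSums]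
      rw [sum_Ico_prepend y y' hy (Nat.zero_le _)]
      simp only [Finset.sum_range_zero]
      linear_combination (norm := module) a1
    · simp [Fin.sum_univ_succ, w2, w, extVec, windowSums]
      rw [sum_Ico_prepend y y' hy (by omega)]
      linear_combination (norm := module) a2 + a3

variable {j : Mode} (v : Vars n j)

lemma scal_add {a b : ℕ} (w w' : Matrix (Fin a) (Fin b) ℝ) :
    scal n (w + w') = scal n w + scal n w' := by
  ext p q
  exact add_mul (w p.1 q.1) (w' p.1 q.1) ((1 : Mat n) p.2 q.2)

lemma scal_smul {a b : ℕ} (t : ℝ) (w : Matrix (Fin a) (Fin b) ℝ) :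
    scal n (t • w) = t • scal n w := by
  ext p q
  exact mul_assoc t (w p.1 q.1) ((1 : Mat n) p.2 q.2)

lemma w_eq_smul (j : Mode) (d : ℝ) : w j d = d • w j 1 := by
  cases j <;>
  · ext r c
    fin_cases r <;> fin_cases c <;> simp [w]

/-- The window sums before and after the step involve the same matrix `w j d`, so the terms
quadratic in it cancel and only the `He` term depends on `d`. -/
lemma qf_Phi1 (hmn : s.dm ≤ s.dn) (hnM : s.dn ≤ s.dM) {d : ℕ} (hd : s.dmj j ≤ d)
    (hd' : d ≤ s.dMj j) (hP : v.P.PosDef) (y y' : ℕ → Fin n → ℝ)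
    (hy : ∀ i, y' (i + 1) = y i) :
    qf (Phi1 s v d) (stack (extVec s j d (y' 0) y))
      = qf v.P (stack (windowSums s j y')) - qf v.P (stack (windowSums s j y)) := by
  rw [← w1_rows s hmn hnM j hd hd' (y' 0) y, ← w2_rows s hmn hnM j hd hd' y y' hy,
    ← scal_mulVec_stack, ← scal_mulVec_stack]
  rw [scal_add, scal_add, add_mulVec, add_mulVec, Phi1, qf_add_mat, qf_sub_mat, qf_conj, qf_conj,
    qf_He_conj, sub_mulVec]
  simp only [qf, bf_add_left, bf_add_right, bf_sub_right]
  rw [bf_comm_of_posDef (scal n (w2 j _ _ _) *ᵥ _) (scal n (w j d) *ᵥ _) hP,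
    bf_comm_of_posDef (scal n (w1 j _ _ _) *ᵥ _) (scal n (w j d) *ᵥ _) hP]
  ring

lemma qf_calQ (d : ℕ) (z : Fin n → ℝ) (y : ℕ → Fin n → ℝ) :
    qf (calQ v) (stack (extVec s j d z y))
      = qf v.Q₁ (y 0) + (qf v.Q₂ (y (s.dmj j)) - qf v.Q₁ (y (s.dmj j)))
        + (j.e * qf v.Q₃ (y (s.dMj j)) - qf v.Q₂ (y (s.dMj j))) := by
  cases j
  · rw [calQ, qf_bdiag]
    simp [Fin.sum_univ_succ, extVec, qf_zero_mat, qf_sub_mat, Mode.e, DelaySystem.dmj,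
      DelaySystem.dMj]
    ring
  · rw [calQ, qf_bdiag]
    simp [Fin.sum_univ_succ, extVec, qf_zero_mat, qf_sub_mat, qf_neg_mat, Mode.e, DelaySystem.dmj,
      DelaySystem.dMj]
    ring

lemma w3_rows (d : ℕ) (z : Fin n → ℝ) (y : ℕ → Fin n → ℝ) :
    (fun r => ∑ c, w3 j r c • extVec s j d z y c) = ![z - y 0] := by
  cases j <;>
  · funext r
    fin_cases r
    simp [Fin.sum_univ_succ, w3, extVec, sub_eq_add_neg]

lemma wS_rows (d : ℕ) (z : Fin n → ℝ) (y : ℕ → Fin n → ℝ) :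
    (fun r => ∑ c, wS j r c • extVec s j d z y c)
      = ![y 0 - y (s.dmj j), y 0 + y (s.dmj j) - (2 : ℝ) • avg 0 (s.dmj j) y] := by
  cases j <;>
  · funext r
    fin_cases r <;>
    · simp [Fin.sum_univ_succ, wS, extVec, DelaySystem.dmj]
      module

lemma wPsiTop_rows (d : ℕ) (z : Fin n → ℝ) (y : ℕ → Fin n → ℝ) :
    (fun r => ∑ c, wPsiTop j r c • extVec s j d z y c)
      = ![y d - y (s.dMj j), y d + y (s.dMj j) - (2 : ℝ) • avg d (s.dMj j) y] := by
  cases j <;>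
  · funext r
    fin_cases r <;>
    · simp [Fin.sum_univ_succ, wPsiTop, extVec, DelaySystem.dMj]
      module

lemma wPsiBot_rows (d : ℕ) (z : Fin n → ℝ) (y : ℕ → Fin n → ℝ) :
    (fun r => ∑ c, wPsiBot j r c • extVec s j d z y c)
      = ![y (s.dmj j) - y d, y (s.dmj j) + y d - (2 : ℝ) • avg (s.dmj j) d y] := by
  cases j <;>
  · funext r
    fin_cases r <;>
    · simp [Fin.sum_univ_succ, wPsiBot, extVec, DelaySystem.dmj]
      module

lemma wZ_rows (d : ℕ) (z : Fin n → ℝ) (y : ℕ → Fin n → ℝ) :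
    (fun r => ∑ c, wZ .one r c • extVec s .one d z y c)
      = ![y s.dn - y s.dM, y s.dn + y s.dM - (2 : ℝ) • avg s.dn s.dM y] := by
  funext r
  fin_cases r <;>
  · simp [Fin.sum_univ_succ, wZ, extVec]
    module

lemma qf_bdiag_pair (A B : Mat n) (u w : Fin n → ℝ) :
    qf (bdiag ![A, B]) (stack ![u, w]) = qf A u + qf B w := by
  rw [qf_bdiag]; simp

lemma fromRows_mulVec_stack (a b : Matrix (Fin 2) (Fin (j.cols + 1)) ℝ)
    (u : Fin (j.cols + 1) → Fin n → ℝ) :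
    fromRows (scal n a) (scal n b) *ᵥ stack u
      = Sum.elim (stack fun r => ∑ c, a r c • u c) (stack fun r => ∑ c, b r c • u c) := by
  rw [fromRows_mulVec, scal_mulVec_stack, scal_mulVec_stack]

lemma qf_Phi3_Z₃ (d : ℕ) (z : Fin n → ℝ) (y : ℕ → Fin n → ℝ) :
    qf ((scal n (wZ j))ᵀ * (j.e • bdiag ![v.Z₃, (3 : ℝ) • v.Z₃]) * scal n (wZ j))
        (stack (extVec s j d z y))
      = j.e * (qf v.Z₃ (y (s.dMj j) - y s.dM)
        + 3 * qf v.Z₃ (y (s.dMj j) + y s.dM - (2 : ℝ) • avg (s.dMj j) s.dM y)) := by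
  rw [qf_conj, qf_smul_mat]
  cases j
  · rw [scal_mulVec_stack, wZ_rows, qf_bdiag_pair, qf_smul_mat, DelaySystem.dMj]
  · simp [Mode.e]

/-- Lower bounds of the increment sums by the quadratic terms of `Φ₃`. -/
lemma qf_Phi3 (hdm : 1 ≤ s.dm) (hmn : s.dm ≤ s.dn) (hnM : s.dn ≤ s.dM) {d : ℕ}
    (hd : s.dmj j ≤ d) (hd' : d ≤ s.dMj j) (hv : v.Positive) (hPsi : (Psi v).PosDef)
    (z : Fin n → ℝ) (y : ℕ → Fin n → ℝ) :
    (s.dmj j : ℝ) ^ 2 * qf v.Z₁ (z - y 0) + s.dDelta j ^ 2 * qf v.Z₂ (z - y 0)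
        + j.e * s.dDeltaM j ^ 2 * qf v.Z₃ (z - y 0)
        - (s.dmj j : ℝ) * ∑ i ∈ Finset.Ico 0 (s.dmj j), qf v.Z₁ (y i - y (i + 1))
        - s.dDelta j * ∑ i ∈ Finset.Ico (s.dmj j) (s.dMj j), qf v.Z₂ (y i - y (i + 1))
        - j.e * (s.dDeltaM j * ∑ i ∈ Finset.Ico (s.dMj j) s.dM, qf v.Z₃ (y i - y (i + 1)))
      ≤ qf (Phi3 s v) (stack (extVec s j d z y)) := by
  obtain ⟨-, -, -, -, hZ₁, hZ₂, hZ₃⟩ := hv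
  have ha : 1 ≤ s.dmj j := by cases j <;> simp only [DelaySystem.dmj] <;> omega
  have hbM : s.dMj j ≤ s.dM := by cases j <;> simp only [DelaySystem.dMj] <;> omega
  rw [Phi3, qf_sub_mat, qf_sub_mat, qf_sub_mat, qf_conj, qf_conj, qf_conj, qf_Phi3_Z₃,
    scal_mulVec_stack, scal_mulVec_stack, WPsi, fromRows_mulVec_stack, w3_rows, wS_rows,
    wPsiTop_rows, wPsiBot_rows, qf_bdiag_pair, qf_bdiag]
  simp only [Fin.sum_univ_succ, Finset.univ_eq_empty, Finset.sum_empty, add_zero, cons_val_zero,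
    qf_add_mat, qf_smul_mat]
  have k1 := wirtinger_window_zero hZ₁ y ha
  have k3 := mul_le_mul_of_nonneg_left (wirtinger_window hZ₃ y hbM) (mode_e_nonneg (j := j))
  have hdr : (s.dmj j : ℝ) ≤ d := by exact_mod_cast hd
  have hdr' : (d : ℝ) ≤ s.dMj j := by exact_mod_cast hd'
  have kb := wirtinger_window hZ₂ y hd
  have kt := wirtinger_window hZ₂ y hd'
  have k2 : qf (Psi v) (Sum.elim
        (stack ![y d - y (s.dMj j), y d + y (s.dMj j) - (2 : ℝ) • avg d (s.dMj j) y])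
        (stack ![y (s.dmj j) - y d, y (s.dmj j) + y d - (2 : ℝ) • avg (s.dmj j) d y]))
      ≤ s.dDelta j * ∑ i ∈ Finset.Ico (s.dmj j) (s.dMj j), qf v.Z₂ (y i - y (i + 1)) := by
    -- If `d` is an end of the delay interval, one subwindow is a single point whose average is its
    -- only value; its vector vanishes, as the degenerate cases of `reciprocally_convex` require.
    have hz : ∀ u : Fin n → ℝ, stack ![u - u, u + u - (2 : ℝ) • u] = 0 := fun u => by
      rw [show u + u - (2 : ℝ) • u = 0 by module, sub_self]
      ext ⟨r, i⟩
      fin_cases r <;> simp [stack]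
    have h := reciprocally_convex hPsi
      (stack ![y d - y (s.dMj j), y d + y (s.dMj j) - (2 : ℝ) • avg d (s.dMj j) y])
      (stack ![y (s.dmj j) - y d, y (s.dmj j) + y d - (2 : ℝ) • avg (s.dmj j) d y])
      (sub_nonneg.mpr hdr) (sub_nonneg.mpr hdr')
      (by rw [qf_bdiag_pair, qf_smul_mat]; exact kb)
      (by rw [qf_bdiag_pair, qf_smul_mat]; exact kt)
      (fun h0 => by
        have : d = s.dmj j := by exact_mod_cast sub_eq_zero.mp h0
        rw [← this, avg_self]
        exact ⟨by simp, hz _⟩)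
      (fun h0 => by
        have : s.dMj j = d := by exact_mod_cast sub_eq_zero.mp h0
        rw [this, avg_self]
        exact ⟨by simp, hz _⟩)
    rw [Finset.sum_Ico_consecutive _ hd hd'] at h
    have e : ((d : ℝ) - s.dmj j) + (s.dMj j - d) = s.dDelta j := by
      rw [DelaySystem.dDelta]; ring
    rwa [e] at h
  rw [DelaySystem.dDeltaM]
  linarith

/-- One step within a mode. -/
lemma qf_calS_step_le (hdm : 1 ≤ s.dm) (hmn : s.dm ≤ s.dn) (hnM : s.dn ≤ s.dM) {d : ℕ}
    (hd : s.dmj j ≤ d) (hd' : d ≤ s.dMj j) (hv : v.Positive) (hPsi : (Psi v).PosDef)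
    (y y' : ℕ → Fin n → ℝ) (hy : ∀ i, y' (i + 1) = y i) :
    qf (calS s v) (stack fun i => y' i) - qf (calS s v) (stack fun i => y i)
      ≤ qf (Phi s v d) (stack (extVec s j d (y' 0) y)) := by
  have hab : s.dmj j ≤ s.dMj j := hd.trans hd'
  have hbM : s.dMj j ≤ s.dM := by cases j <;> simp only [DelaySystem.dMj] <;> omega
  rw [qf_calS s v y hab hbM hv, qf_calS s v y' hab hbM hv, w5_rows s hmn hnM, w5_rows s hmn hnM,
    Phi, qf_add_mat, qf_add_mat, qf_Phi1 s v hmn hnM hd hd' hv.1 y y' hy, qf_calQ]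
  have h1 := tailForm_step s v y hab hbM y' hy
  have h2 := qf_Phi3 s v hdm hmn hnM hd hd' hv hPsi (y' 0) y
  -- In mode 1 the outgoing `Q₃` term at `d_M` is absent from `calQ` and is discarded by its sign;
  -- in mode 2 the two delays coincide and the difference is zero.
  have h3 : qf v.Q₃ (y (s.dMj j)) - qf v.Q₃ (y s.dM) ≤ j.e * qf v.Q₃ (y (s.dMj j)) := by
    cases j
    · have := qf_nonneg (y s.dM) hv.2.2.2.1
      simp only [Mode.e]
      linarith
    · simp [Mode.e, DelaySystem.dMj]
  linarith

/-- For a fixed vector the form of `Φ(d, j)` is affine in `d`. -/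
lemma qf_Phi_affine (x : Fin (j.cols + 1) × Fin n → ℝ) :
    ∃ α β : ℝ, ∀ d : ℕ, qf (Phi s v d) x = α + d * β := by
  refine ⟨qf ((scal n (w2 j (s.dmj j) (s.dMj j) (s.dDeltaM j)))ᵀ * v.P *
        scal n (w2 j (s.dmj j) (s.dMj j) (s.dDeltaM j)) -
      (scal n (w1 j (s.dmj j) (s.dMj j) (s.dDeltaM j)))ᵀ * v.P *
        scal n (w1 j (s.dmj j) (s.dMj j) (s.dDeltaM j))) x + qf (calQ v) x + qf (Phi3 s v) x,
    2 * bf v.P (scal n (w j 1) *ᵥ x) ((scal n (w2 j (s.dmj j) (s.dMj j) (s.dDeltaM j)) -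
      scal n (w1 j (s.dmj j) (s.dMj j) (s.dDeltaM j))) *ᵥ x), fun d => ?_⟩
  rw [Phi, qf_add_mat, qf_add_mat, Phi1, qf_add_mat, qf_He_conj, w_eq_smul, scal_smul,
    smul_mulVec, bf_smul_left]
  ring

end extended_vector

/-! ### From the matrix inequalities to asymptotic stability. -/

section stability

variable {n : ℕ} (s : DelaySystem n)

/-- Stated for all small `ε > 0`, so that finitely many such inequalities can be given a common `ε`
by intersecting filter sets. -/
lemma eventually_qf_le_of_negDef {ι : Type*} [Fintype ι] {Y : Matrix ι ι ℝ} (hY : NegDef Y) :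
    ∀ᶠ ε in 𝓝[>] (0 : ℝ), ∀ x, qf Y x ≤ -(ε * ‖x‖ ^ 2) := by
  obtain ⟨c, hc, h⟩ := exists_qf_upper_of_negDef hY
  filter_upwards [Ioc_mem_nhdsGT hc] with ε hε x
  have : ε * ‖x‖ ^ 2 ≤ c * ‖x‖ ^ 2 := by gcongr; exact hε.2
  linarith [h x]

lemma GammaPerp_mulVec (j : Mode) (d : ℕ) (y : ℕ → Fin n → ℝ) (z : Fin n → ℝ)
    (hz : z = s.A *ᵥ y 0 + s.Amj j *ᵥ y (s.dmj j) + s.AMj j *ᵥ y (s.dMj j) + s.Ad *ᵥ y d) :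
    GammaPerp s j *ᵥ stack (delayVec s j d y) = stack (extVec s j d z y) := by
  rw [GammaPerp, cons_one_mulVec_stack, extVec_eq_cons]
  congr 2
  rw [hz]
  cases j <;>
  · simp [Fin.sum_univ_succ, gammaRow, delayVec, DelaySystem.dmj, DelaySystem.dMj]
    abel

/-- The functional of a mode decreases along the mode. -/
lemma eventually_decrease_mode (hdm : 1 ≤ s.dm) (hmn : s.dm ≤ s.dn) (hnM : s.dn ≤ s.dM)
    {j : Mode} (v : Vars n j) (hv : v.Positive) (hPsi : (Psi v).PosDef)
    (hm : NegDef (projPhi s v (s.dmj j))) (hM : NegDef (projPhi s v (s.dMj j))) :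
    ∀ᶠ ε in 𝓝[>] (0 : ℝ), ∀ (d : ℕ) (y y' : ℕ → Fin n → ℝ), s.dmj j ≤ d → d ≤ s.dMj j →
      (∀ i, y' (i + 1) = y i) →
      y' 0 = s.A *ᵥ y 0 + s.Amj j *ᵥ y (s.dmj j) + s.AMj j *ᵥ y (s.dMj j) + s.Ad *ᵥ y d →
      qf (calS s v) (stack fun i => y' i)
        ≤ qf (calS s v) (stack fun i => y i) - ε * ‖y 0‖ ^ 2 := by
  filter_upwards [eventually_qf_le_of_negDef hm, eventually_qf_le_of_negDef hM,
    self_mem_nhdsWithin] with ε h1 h2 hε d y y' hd hd' hy hz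
  have hε : 0 < ε := hε
  have h1 := h1 (stack (delayVec s j d y))
  have h2 := h2 (stack (delayVec s j d y))
  rw [projPhi, qf_conj, GammaPerp_mulVec s j d y _ hz] at h1 h2
  obtain ⟨α, β, hαβ⟩ := qf_Phi_affine s v (stack (extVec s j d (y' 0) y))
  have h3 := qf_calS_step_le s v hdm hmn hnM hd hd' hv hPsi y y' hy
  rw [hαβ] at h1 h2 h3
  have h4 : ‖y 0‖ ≤ ‖stack (delayVec s j d y)‖ := by
    cases j
    · exact norm_le_norm_stack (delayVec s .one d y) 0
    · exact norm_le_norm_stack (delayVec s .two d y) 0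
  have h5 : ε * ‖y 0‖ ^ 2 ≤ ε * ‖stack (delayVec s j d y)‖ ^ 2 := by gcongr
  have hd1 : (s.dmj j : ℝ) ≤ d := by exact_mod_cast hd
  have hd2 : (d : ℝ) ≤ s.dMj j := by exact_mod_cast hd'
  -- An affine function of `d` is bounded by its value at one end of the interval; the sign of the
  -- slope decides which.
  rcases le_total 0 β with hβ | hβ
  · have := mul_le_mul_of_nonneg_right hd2 hβ
    linarith
  · have := mul_le_mul_of_nonpos_right hd1 hβ
    linarith

lemma lRow_sum (hnM : s.dn ≤ s.dM) {l : ℕ} (hl : l ≤ s.dM) (y : ℕ → Fin n → ℝ) :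
    ∑ c : Fin (s.dM + 1), lRow s l c *ᵥ y c = s.A *ᵥ y 0 + s.An *ᵥ y s.dn + s.Ad *ᵥ y l := by
  have h : ∀ (M : Mat n) (p : ℕ), p ≤ s.dM →
      ∑ c : Fin (s.dM + 1), (if (c : ℕ) = p then M else 0) *ᵥ y c = M *ᵥ y p := by
    intro M p hp
    rw [Finset.sum_eq_single ⟨p, by omega⟩]
    · simp
    · intro c _ hc
      rw [if_neg fun h => hc (Fin.ext h), zero_mulVec]
    · simp
  simp only [lRow, add_mulVec, Finset.sum_add_distrib]
  rw [h _ 0 (Nat.zero_le _), h _ _ hnM, h _ _ hl]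

/-- `LPerp` extends the history by the next state. Of the extended string, `padLast` reads the
leading blocks, which form the next history, and `padFirst` reads the trailing ones, which form the
current history. -/
lemma qf_crossMat (hnM : s.dn ≤ s.dM) {l : ℕ} (hl : l ≤ s.dM)
    (S S' : BMat (s.dM + 1) (s.dM + 1) n) (y y' : ℕ → Fin n → ℝ) (hy : ∀ i, y' (i + 1) = y i)
    (hz : y' 0 = s.A *ᵥ y 0 + s.An *ᵥ y s.dn + s.Ad *ᵥ y l) :
    qf (crossMat s S S' l) (stack fun i => y i)
      = qf S (stack fun i => y' i) - qf S' (stack fun i => y i) := by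
  have h : vecCons (∑ c : Fin (s.dM + 1), lRow s l c *ᵥ y c) (fun i : Fin (s.dM + 1) => y i)
      = fun i : Fin (s.dM + 1 + 1) => y' i := by
    rw [lRow_sum s hnM hl, ← hz]
    funext i
    refine Fin.cases rfl (fun i => ?_) i
    rw [cons_val_succ, Fin.val_succ, hy]
  rw [crossMat, qf_conj, LPerp, cons_one_mulVec_stack, h, qf_sub_mat, qf_padLast, qf_padFirst]
  simp only [Fin.val_succ, hy, Fin.val_castSucc]

lemma eventually_decrease_cross (hnM : s.dn ≤ s.dM) (S S' : BMat (s.dM + 1) (s.dM + 1) n)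
    {p q : ℕ} (hq : q ≤ s.dM) (h : ∀ l, p ≤ l → l ≤ q → NegDef (crossMat s S S' l)) :
    ∀ᶠ ε in 𝓝[>] (0 : ℝ), ∀ (d : ℕ) (y y' : ℕ → Fin n → ℝ), p ≤ d → d ≤ q →
      (∀ i, y' (i + 1) = y i) →
      y' 0 = s.A *ᵥ y 0 + s.An *ᵥ y s.dn + s.Ad *ᵥ y d →
      qf S (stack fun i => y' i) ≤ qf S' (stack fun i => y i) - ε * ‖y 0‖ ^ 2 := by
  -- Only finitely many delays occur, so one `ε` serves them all.
  have key : ∀ᶠ ε in 𝓝[>] (0 : ℝ), ∀ l ∈ Finset.Icc p q, ∀ x,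
      qf (crossMat s S S' l) x ≤ -(ε * ‖x‖ ^ 2) := by
    rw [Finset.eventually_all]
    intro l hl
    rw [Finset.mem_Icc] at hl
    exact eventually_qf_le_of_negDef (h l hl.1 hl.2)
  filter_upwards [key, self_mem_nhdsWithin] with ε hε hpos d y y' hd hd' hy hz
  have hpos : 0 < ε := hpos
  have h1 := hε d (Finset.mem_Icc.mpr ⟨hd, hd'⟩) (stack fun i => y i)
  rw [qf_crossMat s hnM (hd'.trans hq) S S' y y' hy hz] at h1
  have h2 : ‖y 0‖ ≤ ‖stack fun i : Fin (s.dM + 1) => y i‖ :=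
    norm_le_norm_stack (fun i : Fin (s.dM + 1) => y i) 0
  have h3 : ε * ‖y 0‖ ^ 2 ≤ ε * ‖stack fun i : Fin (s.dM + 1) => y i‖ ^ 2 := by gcongr
  linarith

/-- A Lyapunov–Krasovskii functional that is a function of the history gives asymptotic
stability. -/
lemma asymptoticallyStable_of_functional {m : ℕ} {sol : (ℤ → Fin n → ℝ) → Prop}
    (U : (Fin (m + 1) × Fin n → ℝ) → ℝ) (hU : Continuous U) (hU0 : U 0 = 0) {c ε : ℝ}
    (hc : 0 < c) (hε : 0 < ε)
    (hlow : ∀ y : ℕ → Fin n → ℝ, c * ‖y 0‖ ^ 2 ≤ U (stack fun i => y i))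
    (hdec : ∀ x, sol x → ∀ k : ℕ, U (stack fun i => x (((k + 1 : ℕ) : ℤ) - (i : ℕ)))
      ≤ U (stack fun i => x ((k : ℤ) - (i : ℕ))) - ε * ‖x k‖ ^ 2) :
    AsymptoticallyStable m sol := by
  have hlow' : ∀ (x : ℤ → Fin n → ℝ) (k : ℕ),
      c * ‖x k‖ ^ 2 ≤ U (stack fun i => x ((k : ℤ) - (i : ℕ))) := fun x k => by
    simpa using hlow fun i => x ((k : ℤ) - (i : ℕ))
  have hsum : ∀ x, sol x → ∀ k : ℕ, U (stack fun i => x ((k : ℤ) - (i : ℕ)))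
      + ∑ i ∈ Finset.range k, ε * ‖x i‖ ^ 2 ≤ U (stack fun i => x (((0 : ℕ) : ℤ) - (i : ℕ))) := by
    intro x hx k
    induction k with
    | zero => simp
    | succ k ih =>
      rw [Finset.sum_range_succ]
      linarith [hdec x hx k]
  refine ⟨fun η hη => ?_, fun x hx => ?_⟩
  · have hcη : 0 < c * η ^ 2 := by positivity
    have hnhds : ∀ᶠ z in 𝓝 (0 : Fin (m + 1) × Fin n → ℝ), U z < c * η ^ 2 :=
      hU.continuousAt.eventually_lt continuousAt_const (by rwa [hU0])
    obtain ⟨δ, hδ, hball⟩ := Metric.eventually_nhds_iff.mp hnhds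
    refine ⟨δ, hδ, fun x hx hinit k => ?_⟩
    have h0 : U (stack fun i => x (((0 : ℕ) : ℤ) - (i : ℕ))) < c * η ^ 2 := by
      apply hball
      rw [dist_zero_right]
      refine norm_stack_lt _ hδ fun i => hinit _ ?_ ?_ <;> omega
    have h1 : 0 ≤ ∑ i ∈ Finset.range k, ε * ‖x i‖ ^ 2 :=
      Finset.sum_nonneg fun i _ => by positivity
    have h2 : c * ‖x k‖ ^ 2 < c * η ^ 2 := by linarith [hsum x hx k, hlow' x k]
    exact lt_of_pow_lt_pow_left₀ 2 hη.le (lt_of_mul_lt_mul_left h2 hc.le)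
  -- The partial sums are bounded by the initial value of `U`, because `U` is nonnegative along the
  -- solution.
  · have hs : Summable fun k : ℕ => ε * ‖x k‖ ^ 2 := by
      refine summable_of_sum_range_le (fun k => by positivity)
        (c := U (stack fun i => x (((0 : ℕ) : ℤ) - (i : ℕ)))) fun k => ?_
      have h1 : 0 ≤ c * ‖x k‖ ^ 2 := by positivity
      linarith [hsum x hx k, hlow' x k]
    have h1 := (hs.tendsto_atTop_zero.const_mul ε⁻¹).sqrt
    rw [tendsto_zero_iff_norm_tendsto_zero]
    simpa [← mul_assoc, inv_mul_cancel₀ hε.ne'] using h1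

/-- In either mode one of the two matrices is zero and the other is `An`, acting at delay `d_n`. -/
lemma isSwitchedSolution_iff (d : ℕ → ℕ) (x : ℤ → Fin n → ℝ) :
    s.IsSwitchedSolution d x ↔ s.IsSolution d x := by
  refine forall_congr' fun k => ?_
  rw [DelaySystem.f, DelaySystem.sigma]
  split_ifs <;> simp [DelaySystem.Amj, DelaySystem.AMj, DelaySystem.dmj, DelaySystem.dMj]

/-- Asymptotic stability of the delay system under the mode and cross-mode inequalities. -/
lemma asymptoticallyStable_isSolution
    (hdm : 1 ≤ s.dm) (hmn : s.dm ≤ s.dn) (hnM : s.dn ≤ s.dM)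
    (v : (j : Mode) → Vars n j) (hpos : ∀ j, (v j).Positive) (hPsi : ∀ j, (Psi (v j)).PosDef)
    (hPhi_m : ∀ j, NegDef (projPhi s (v j) (s.dmj j)))
    (hPhi_M : ∀ j, NegDef (projPhi s (v j) (s.dMj j)))
    (hcross₁ : ∀ l : ℕ, s.dmj .one ≤ l → l ≤ s.dMj .one →
      NegDef (crossMat s (calS s (v .one)) (calS s (v .two)) l))
    (hcross₂ : ∀ l : ℕ, s.dmj .two ≤ l → l ≤ s.dMj .two →
      NegDef (crossMat s (calS s (v .two)) (calS s (v .one)) l))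
    (d : ℕ → ℕ) (hd : ∀ k, s.dm ≤ d k ∧ d k ≤ s.dM) :
    AsymptoticallyStable s.dM (s.IsSolution d) := by
  obtain ⟨ε, hm₁, hm₂, hx₁, hx₂, hε⟩ :=
    ((eventually_decrease_mode s hdm hmn hnM (v .one) (hpos _) (hPsi _) (hPhi_m _)
      (hPhi_M _)).and <|
    (eventually_decrease_mode s hdm hmn hnM (v .two) (hpos _) (hPsi _) (hPhi_m _)
      (hPhi_M _)).and <|
    (eventually_decrease_cross s hnM _ _ (show s.dMj .one ≤ s.dM from hnM) hcross₁).and <|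
    (eventually_decrease_cross s hnM _ _ (show s.dMj .two ≤ s.dM from le_rfl) hcross₂).and
      self_mem_nhdsWithin).exists
  obtain ⟨c₁, hc₁, hl₁⟩ := exists_qf_calS_lower s (v .one) hmn hnM (hpos _)
  obtain ⟨c₂, hc₂, hl₂⟩ := exists_qf_calS_lower s (v .two) hnM le_rfl (hpos _)
  refine asymptoticallyStable_of_functional
    (fun z => min (qf (calS s (v .one)) z) (qf (calS s (v .two)) z))
    ((continuous_qf _).min (continuous_qf _)) (by simp [qf_zero]) (lt_min hc₁ hc₂) hε
    (fun y => le_min ?_ ?_) (fun x hx k => ?_)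
  · exact (mul_le_mul_of_nonneg_right (min_le_left _ _) (by positivity)).trans (hl₁ y)
  · exact (mul_le_mul_of_nonneg_right (min_le_right _ _) (by positivity)).trans (hl₂ y)
  · set y : ℕ → Fin n → ℝ := fun i => x ((k : ℤ) - (i : ℕ)) with hy
    set y' : ℕ → Fin n → ℝ := fun i => x (((k + 1 : ℕ) : ℤ) - (i : ℕ)) with hy'
    have hshift : ∀ i, y' (i + 1) = y i := fun i => by
      simp only [hy, hy']
      congr 1
      push_cast
      ring
    have hrec : y' 0 = s.A *ᵥ y 0 + s.An *ᵥ y s.dn + s.Ad *ᵥ y (d k) := by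
      simpa [hy, hy'] using hx k
    have h0 : y 0 = x k := by simp [hy]
    rw [← h0, le_sub_iff_add_le, le_min_iff, ← le_sub_iff_add_le, ← le_sub_iff_add_le]
    -- The functional of the mode active at time `k` is evaluated at `k + 1`: the mode inequality
    -- puts it below its own old value, the cross inequality below that of the other functional.
    rcases le_or_gt (d k) s.dn with h | h
    · have e1 := hm₁ (d k) y y' (hd k).1 h hshift
        (by simpa [DelaySystem.Amj, DelaySystem.AMj, DelaySystem.dmj, DelaySystem.dMj] using hrec)
      have e2 := hx₁ (d k) y y' (hd k).1 h hshift hrec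
      exact ⟨(min_le_left _ _).trans e1, (min_le_left _ _).trans e2⟩
    · have e1 := hm₂ (d k) y y' h.le (hd k).2 hshift
        (by simpa [DelaySystem.Amj, DelaySystem.AMj, DelaySystem.dmj, DelaySystem.dMj] using hrec)
      have e2 := hx₂ (d k) y y' h.le (hd k).2 hshift hrec
      exact ⟨(min_le_right _ _).trans e2, (min_le_right _ _).trans e1⟩

end stability

end DelayLMI

end

theorem theorem1 {n : ℕ} (s : DelayLMI.DelaySystem n)
    (hdm : 1 ≤ s.dm) (hmn : s.dm ≤ s.dn) (hnM : s.dn ≤ s.dM)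
    (v : (j : DelayLMI.Mode) → DelayLMI.Vars n j)
    (hpos : ∀ j, (v j).Positive)
    (hPsi : ∀ j, (DelayLMI.Psi (v j)).PosDef)
    (hPhi_m : ∀ j, DelayLMI.NegDef (DelayLMI.projPhi s (v j) (s.dmj j)))
    (hPhi_M : ∀ j, DelayLMI.NegDef (DelayLMI.projPhi s (v j) (s.dMj j)))
    (hcross₁ : ∀ l : ℕ, s.dmj .one ≤ l → l ≤ s.dMj .one →
      DelayLMI.NegDef (DelayLMI.crossMat s (DelayLMI.calS s (v .one)) (DelayLMI.calS s (v .two)) l))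
    (hcross₂ : ∀ l : ℕ, s.dmj .two ≤ l → l ≤ s.dMj .two →
      DelayLMI.NegDef
        (DelayLMI.crossMat s (DelayLMI.calS s (v .two)) (DelayLMI.calS s (v .one)) l)) :
    ∀ d : ℕ → ℕ, (∀ k, s.dm ≤ d k ∧ d k ≤ s.dM) →
      DelayLMI.AsymptoticallyStable s.dM (s.IsSwitchedSolution d) ∧
      DelayLMI.AsymptoticallyStable s.dM (s.IsSolution d) := by
  intro d hd
  have main := DelayLMI.asymptoticallyStable_isSolution s hdm hmn hnM v hpos hPsi hPhi_m hPhi_M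
    hcross₁ hcross₂ d hd
  have h : s.IsSwitchedSolution d = s.IsSolution d :=
    funext fun x => propext (DelayLMI.isSwitchedSolution_iff s d x)
  exact ⟨h ▸ main, main⟩
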